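/- Let $n\ge 1$ and let $H=-\Delta+|x|^2$ be the Hermite operator on $\mathbb R^n$. Let $\Phi_\alpha$ ($\alpha\in\mathbb N^n$) be the $L^2$-normalized Hermite functions, $H\Phi_\alpha=(2|\alpha|+n)\Phi_\alpha$, and let $e^{-tH}\varphi=\sum_\alpha e^{-(2|\alpha|+n)t}(\varphi,\Phi_\alpha)\Phi_\alpha$ be the Hermite semigroup on $L^2(\mathbb R^n)$. For $t>0$ let the Hermite–Bergman space $\mathcal H_t(\mathbb C^n)$ be the space of entire functions $F$ on $\mathbb C^n$ whose restriction to $\mathbb R^n$ equals $e^{-tH}\varphi$ (almost everywhere) for some $\varphi\in L^2(\mathbb R^n)$, and put $\mathcal H_\infty(\mathbb C^n)=\bigcap_{t>0}\mathcal H_t(\mathbb C^n)$. Write $\hat f(\xi)=(2\pi)^{-n/2}\int_{\mathbb R^n}f(x)e^{-ix\cdot\xi}\,dx$ and $z^2=z_1^2+\dots+z_n^2$. Theorem. Let $F$ be an entire function on $\mathbb C^n$ and let $f$ be its restriction to $\mathbb R^n$. Then $F\in\mathcal H_\infty(\mathbb C^n)$ if and only if $f$ satisfies the Pfannschmidt condition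 with $a=b=1$, that is, there are functions $P,Q:\mathbb R^n\to(0,\infty)$ such that $$|f(x)|\le P(x)e^{-\frac12|x|^2},\qquad |\hat f(\xi)|\le Q(\xi)e^{-\frac12|\xi|^2}\qquad\text{for all }x,\xi\in\mathbb R^n,$$ $$\limsup_{|x|\to\infty}\frac{\log P(x)}{|x|^2}=0=\limsup_{|\xi|\to\infty}\frac{\log Q(\xi)}{|\xi|^2}.$$ (As $f$ is continuous, the bound on $f$ makes it integrable, so that $\hat f$ is defined.) If $F\in\mathcal H_\infty(\mathbb C^n)$, then $f$ is integrable, there is $G\in\mathcal H_\infty(\mathbb C^n)$ with $G=\hat f$ on $\mathbb R^n$, and both $F(z)e^{z^2/2}$ and $G(z)e^{z^2/2}$ are entire functions on $\mathbb C^n$ of order $2$ and at most of minimal type; that is, each of them is an entire function $R$ such that for every $\varepsilon>0$ there is a constant $C_\varepsilon$ with $|R(z)|\le C_\varepsilon e^{\varepsilon|z|^2}$ for all $z\in\mathbb C^n$. -/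

import Mathlib

open MeasureTheory Filter Topology

noncomputable section

/-- The inclusion of `ℝⁿ` into `ℂⁿ` (both with their Euclidean norms). -/
def realToComplex {n : ℕ} (x : EuclideanSpace ℝ (Fin n)) : EuclideanSpace ℂ (Fin n) :=
  WithLp.toLp 2 (fun j => (x j : ℂ))

/-- The restriction to `ℝⁿ` of a function on `ℂⁿ`. -/
def realRestriction {n : ℕ} (F : EuclideanSpace ℂ (Fin n) → ℂ) :
    EuclideanSpace ℝ (Fin n) → ℂ :=
  fun x => F (realToComplex x)

/-- The `k`-th Hermite function on `ℝ`, normalized in `L²(ℝ)`: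
`h_k(x) = (2^k k! √π)^(-1/2) H_k(x) exp(-x²/2)`. Mathlib's `Polynomial.hermite k` is the
probabilists' polynomial `He_k`, and `H_k(x) = 2^(k/2) He_k(√2 x)`, so the powers of `2`
cancel. -/
def hermiteFun (k : ℕ) (x : ℝ) : ℝ :=
  (Real.sqrt (k.factorial * Real.sqrt Real.pi))⁻¹ *
    Polynomial.aeval (Real.sqrt 2 * x) (Polynomial.hermite k) * Real.exp (-x ^ 2 / 2)

/-- The Hermite functions `Φ_α(x) = ∏ j, h_{α_j}(x_j)` on `ℝⁿ`. They form an orthonormal basis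
of `L²(ℝⁿ)` and `H Φ_α = (2|α| + n) Φ_α` for the Hermite operator `H = -Δ + |x|²`. -/
def hermiteFunction {n : ℕ} (α : Fin n → ℕ) (x : EuclideanSpace ℝ (Fin n)) : ℝ :=
  ∏ j, hermiteFun (α j) (x j)

/-- The Hermite coefficient `(φ, Φ_α)` (the functions `Φ_α` are real valued). -/
def hermiteCoeff {n : ℕ} (φ : EuclideanSpace ℝ (Fin n) → ℂ) (α : Fin n → ℕ) : ℂ :=
  ∫ x, φ x * (hermiteFunction α x : ℂ)

/-- `g = e^{-tH} φ` in `L²(ℝⁿ)`, where `H = -Δ + |x|²`: the unconditional `L²`-convergence of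
`g = ∑_α e^{-(2|α| + n)t} (φ, Φ_α) Φ_α`. -/
def IsHermiteSemigroup {n : ℕ} (t : ℝ) (φ g : EuclideanSpace ℝ (Fin n) → ℂ) : Prop :=
  Tendsto
    (fun s : Finset (Fin n → ℕ) =>
      eLpNorm
        (fun x => g x - ∑ α ∈ s,
          (Real.exp (-((2 * ∑ j, (α j : ℝ)) + n) * t) : ℂ) * hermiteCoeff φ α *
            (hermiteFunction α x : ℂ))
        2 volume)
    atTop (𝓝 0)

/-- The Hermite-Bergman space `H_t(ℂⁿ)`: the image of `L²(ℝⁿ)` under `e^{-tH}`, each element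
being identified with its entire extension to `ℂⁿ`. -/
def HermiteBergman (n : ℕ) (t : ℝ) : Set (EuclideanSpace ℂ (Fin n) → ℂ) :=
  {F | Differentiable ℂ F ∧
    ∃ φ : EuclideanSpace ℝ (Fin n) → ℂ,
      MemLp φ 2 volume ∧ IsHermiteSemigroup t φ (realRestriction F)}

/-- `H_∞(ℂⁿ) = ⋂_{t > 0} H_t(ℂⁿ)`. -/
def HermiteBergmanInf (n : ℕ) : Set (EuclideanSpace ℂ (Fin n) → ℂ) :=
  ⋂ t ∈ Set.Ioi (0 : ℝ), HermiteBergman n t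

/-- The unitarily normalized Fourier transform of an integrable function `f` on `ℝⁿ`,
`(2π)^(-n/2) ∫ f(x) exp(-i x·ξ) dx`. -/
def unitaryFourier {n : ℕ} (f : EuclideanSpace ℝ (Fin n) → ℂ)
    (ξ : EuclideanSpace ℝ (Fin n)) : ℂ :=
  (((2 * Real.pi) ^ (-(n : ℝ) / 2) : ℝ) : ℂ) *
    ∫ x, Complex.exp (-Complex.I * ((inner ℝ x ξ : ℝ) : ℂ)) * f x

/-- `limsup_{|x| → ∞} log P(x) / |x|² = 0` for a positive function `P` on `ℝⁿ`. The limsup is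
taken in the extended reals, so that it is the true one also when the quotient is unbounded. -/
def LogLimsupZero {n : ℕ} (P : EuclideanSpace ℝ (Fin n) → ℝ) : Prop :=
  limsup (fun x => ((Real.log (P x) / ‖x‖ ^ 2 : ℝ) : EReal))
    (Bornology.cobounded (EuclideanSpace ℝ (Fin n))) = 0

/-- The Pfannschmidt condition with parameters `a, b`. It is applied below only to continuous
`f`, for which the bound on `f` (with `a > 0`) makes `f` integrable. -/
def PfannschmidtCondition {n : ℕ} (a b : ℝ) (f : EuclideanSpace ℝ (Fin n) → ℂ) : Prop :=
  Measurable f ∧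
  ∃ P Q : EuclideanSpace ℝ (Fin n) → ℝ,
    (∀ x, 0 < P x) ∧ (∀ ξ, 0 < Q ξ) ∧
    (∀ x, ‖f x‖ ≤ P x * Real.exp (-(1 / 2) * a * ‖x‖ ^ 2)) ∧
    (∀ ξ, ‖unitaryFourier f ξ‖ ≤ Q ξ * Real.exp (-(1 / 2) * b * ‖ξ‖ ^ 2)) ∧
    LogLimsupZero P ∧ LogLimsupZero Q

/-- `R` is entire on `ℂⁿ`, of order 2 and at most of minimal type, in the usual sense of a
growth bound: for every `ε > 0`, `|R(z)| = O(exp(ε|z|²))`. Equivalently the order of `R` is at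
most `2` and, if it equals `2`, the type of `R` is `0`. -/
def IsEntireOrderTwoMinimalType {n : ℕ} (R : EuclideanSpace ℂ (Fin n) → ℂ) : Prop :=
  Differentiable ℂ R ∧
    ∀ ε : ℝ, 0 < ε → ∃ C : ℝ, ∀ z, ‖R z‖ ≤ C * Real.exp (ε * ‖z‖ ^ 2)

/-- The function `z ↦ F(z) exp(z²/2)` on `ℂⁿ`, where `z² = ∑ j, z_j²`. -/
def mulExpHalfSq {n : ℕ} (F : EuclideanSpace ℂ (Fin n) → ℂ) :
    EuclideanSpace ℂ (Fin n) → ℂ :=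
  fun z => F z * Complex.exp ((1 / 2) * ∑ j, z j ^ 2)

end

noncomputable section

/-! Both conditions are equivalent to a third: the Hermite coefficients of `f` decay faster than
every geometric sequence in `|α|` (`RapidDecay`), and `f` is the sum of its Hermite series.

For `H_∞`, the coefficients of `e^{-tH}φ` carry the factor `e^{-(2|α|+n)t}` with `t` arbitrary.
Conversely, dividing rapidly decaying coefficients by that factor leaves them rapidly decaying, so a
preimage `φ` exists for each `t`. Rapid decay also gives the growth statements. The normalized
Hermite polynomials satisfy `|p_α(z)| ≤ B^|α| e^{ε|z|²}` with `B` depending on `ε` only, so `∑ c_α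
p_α`, which is `F(z)e^{z²/2}`, is entire of minimal type. The Fourier transform multiplies `c_α` by
`(-i)^|α|`, hence preserves the class, and the Pfannschmidt bounds follow on both sides.

The converse uses the Bargmann transform `B`, whose Taylor coefficients are the Hermite coefficients
times constants of size `(α!)^{-1/2}`. The Gaussian bound on `f` controls `B` by `exp(|Im z|²/2 +
2ε|Re z|²)`. The Fourier transform becomes the rotation `z ↦ -iz`, so the bound on its transform
gives the same estimate with real and imaginary parts exchanged. A Phragmén–Lindelöf argument
(`exists_minimalType_bound`) turns the two into minimal type for `B`, and Cauchy's inequalities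
(`norm_coeff_le_of_norm_tsum_le`) give rapid decay. Injectivity of the Hermite expansion
(`eq_zero_of_hermiteCoeff_eq_zero`), itself reduced to Fourier inversion, identifies `f` with its
series. -/

/-! ### Growth of the Hermite polynomials on the complex plane -/

theorem Polynomial.derivative_hermite_succ (k : ℕ) :
    Polynomial.derivative (Polynomial.hermite (k + 1)) =
      ((k : Polynomial ℤ) + 1) * Polynomial.hermite k := by
  induction k with
  | zero => simp
  | succ k ih =>
    rw [Polynomial.hermite_succ (k + 1), Polynomial.derivative_sub, Polynomial.derivative_mul, ih,
      Polynomial.derivative_mul]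
    simp only [Polynomial.derivative_X, Polynomial.derivative_add, Polynomial.derivative_natCast,
      Polynomial.derivative_one, Polynomial.hermite_succ k]
    push_cast
    ring

/-- The three-term recurrence for the probabilists' Hermite polynomials. -/
theorem Polynomial.hermite_succ_succ (k : ℕ) :
    Polynomial.hermite (k + 2) =
      Polynomial.X * Polynomial.hermite (k + 1) - ((k : Polynomial ℤ) + 1) * Polynomial.hermite k := by
  rw [Polynomial.hermite_succ (k + 1), Polynomial.derivative_hermite_succ]

/-- Induction along the three-term recurrence: with `a = ‖z‖` and `s = √(k+1)`, the step reduces to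
`a(a+s) + s² ≤ (a+s)²`. -/
theorem norm_aeval_hermite_le (z : ℂ) (k : ℕ) :
    ‖Polynomial.aeval z (Polynomial.hermite k)‖ ≤ (‖z‖ + √k) ^ k := by
  induction k using Nat.twoStepInduction with
  | zero => simp
  | one => simp
  | more k h0 h1 =>
    have hz := norm_nonneg z
    have s0 := Real.sqrt_nonneg (k : ℝ)
    have s1 := Real.sqrt_nonneg ((k : ℝ) + 1)
    have s01 : √(k : ℝ) ≤ √((k : ℝ) + 1) := Real.sqrt_le_sqrt (by linarith)
    have s12 : √((k : ℝ) + 1) ≤ √((k : ℝ) + 1 + 1) := Real.sqrt_le_sqrt (by linarith)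
    have sq1 : √((k : ℝ) + 1) * √((k : ℝ) + 1) = k + 1 := Real.mul_self_sqrt (by positivity)
    push_cast at h1 ⊢
    rw [show (k : ℝ) + 2 = k + 1 + 1 by ring]
    set a := ‖z‖
    set s := √((k : ℝ) + 1)
    have e : Polynomial.aeval z (Polynomial.hermite (k + 2)) =
        z * Polynomial.aeval z (Polynomial.hermite (k + 1)) -
          ((k : ℂ) + 1) * Polynomial.aeval z (Polynomial.hermite k) := by
      rw [Polynomial.hermite_succ_succ]; simp
    have nk : ‖(k : ℂ) + 1‖ = k + 1 := by
      rw [← Nat.cast_succ, Complex.norm_natCast]; push_cast; rfl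
    calc _ ≤ a * (a + s) ^ (k + 1) + (k + 1) * (a + √k) ^ k := by
          rw [e]
          refine (norm_sub_le _ _).trans ?_
          rw [norm_mul, norm_mul, nk]
          gcongr
      _ ≤ a * (a + s) ^ (k + 1) + (s * s) * (a + s) ^ k := by
          rw [sq1]; gcongr
      _ = (a + s) ^ k * (a * (a + s) + s * s) := by ring
      _ ≤ (a + s) ^ k * (a + s) ^ 2 := by gcongr; nlinarith
      _ = (a + s) ^ (k + 2) := by ring
      _ ≤ _ := by gcongr

/-- The polynomial factor of the `k`-th Hermite function, as a function on `ℂ`. -/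
def hermitePoly (k : ℕ) (z : ℂ) : ℂ :=
  ((√(k.factorial * √Real.pi))⁻¹ : ℝ) * Polynomial.aeval (√2 * z) (Polynomial.hermite k)

theorem hermiteFun_eq (k : ℕ) (x : ℝ) :
    (hermiteFun k x : ℂ) = hermitePoly k x * Complex.exp (-(x : ℂ) ^ 2 / 2) := by
  have : ((Polynomial.aeval (√2 * x) (Polynomial.hermite k) : ℝ) : ℂ) =
      Polynomial.aeval ((√2 : ℂ) * x) (Polynomial.hermite k) := by
    rw [← Complex.ofReal_mul]
    exact (Polynomial.aeval_algebraMap_apply ℂ (√2 * x) (Polynomial.hermite k)).symm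
  simp only [hermiteFun, hermitePoly]
  push_cast
  rw [this]

theorem one_le_sqrt_pi : 1 ≤ √Real.pi := by
  rw [Real.one_le_sqrt]; linarith [Real.pi_gt_three]

/-- The factor `√k ^ k` of the crude bound is absorbed by the normalization, since `k^k ≤ e^k k!`.
The rest is at most `exp(√2‖z‖√k)`, which the arithmetic-geometric mean inequality splits into
`k/(2ε) + ε‖z‖²`; hence the value of `B`. -/
theorem exists_norm_hermitePoly_le {ε : ℝ} (hε : 0 < ε) :
    ∃ B : ℝ, 1 ≤ B ∧ ∀ k z, ‖hermitePoly k z‖ ≤ B ^ k * Real.exp (ε * ‖z‖ ^ 2) := by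
  refine ⟨Real.exp (1 + 1 / (2 * ε)), Real.one_le_exp (by positivity), fun k z => ?_⟩
  have hf : (0 : ℝ) < k.factorial := by exact_mod_cast k.factorial_pos
  have hsf : 0 < √(k.factorial : ℝ) := Real.sqrt_pos.2 hf
  have h1 : ‖hermitePoly k z‖ ≤ (√2 * ‖z‖ + √k) ^ k / √(k.factorial : ℝ) := by
    rw [hermitePoly, norm_mul, Complex.norm_real, Real.norm_of_nonneg (by positivity),
      div_eq_inv_mul]
    gcongr
    · exact le_mul_of_one_le_right hf.le one_le_sqrt_pi
    · refine (norm_aeval_hermite_le _ _).trans_eq ?_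
      rw [norm_mul, Complex.norm_real, Real.norm_of_nonneg (by positivity)]
  refine h1.trans ?_
  rw [div_le_iff₀ hsf, ← Real.exp_nat_mul, ← Real.exp_add]
  have hkk : √(k : ℝ) ^ k ≤ Real.exp k * √(k.factorial : ℝ) := by
    have h2 := Real.pow_div_factorial_le_exp k (by positivity) k
    rw [div_le_iff₀ hf] at h2
    have h3 : √((k : ℝ) ^ k) ≤ √(Real.exp k * k.factorial) := Real.sqrt_le_sqrt h2
    have h4 : √((k : ℝ) ^ k) = √(k : ℝ) ^ k := by
      rw [Real.sqrt_eq_iff_mul_self_eq (by positivity) (by positivity), ← mul_pow,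
        Real.mul_self_sqrt (by positivity)]
    rw [h4, Real.sqrt_mul (by positivity)] at h3
    refine h3.trans ?_
    gcongr
    rw [Real.sqrt_le_left (by positivity)]
    nlinarith [Real.one_le_exp (show (0 : ℝ) ≤ k by positivity)]
  rcases Nat.eq_zero_or_pos k with rfl | hk
  · simp; positivity
  have hk' : (0 : ℝ) < k := by exact_mod_cast hk
  have hsk : 0 < √(k : ℝ) := Real.sqrt_pos.2 hk'
  have hkk' : √(k : ℝ) * √(k : ℝ) = k := Real.mul_self_sqrt hk'.le
  have h5 : (√2 * ‖z‖ + √k) ^ k ≤ √(k : ℝ) ^ k * Real.exp (√2 * ‖z‖ * √k) := by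
    have : √2 * ‖z‖ + √k = √(k : ℝ) * (√2 * ‖z‖ / √k + 1) := by field_simp
    rw [this, mul_pow]
    gcongr
    refine (pow_le_pow_left₀ (by positivity) (Real.add_one_le_exp _) k).trans_eq ?_
    rw [← Real.exp_nat_mul]
    congr 1
    nth_rewrite 1 [← hkk']
    field_simp
  have h6 : √2 * ‖z‖ * √k ≤ k * (1 / (2 * ε)) + ε * ‖z‖ ^ 2 := by
    have h2 : √(2 : ℝ) * √2 = 2 := Real.mul_self_sqrt (by norm_num)
    have h7 : 0 ≤ (√2 * ε * ‖z‖ - √k) ^ 2 := sq_nonneg _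
    have : (√2 * ε * ‖z‖ - √k) ^ 2 = 2 * ε * (k * (1 / (2 * ε)) + ε * ‖z‖ ^ 2 - √2 * ‖z‖ * √k) := by
      field_simp
      linear_combination (ε ^ 2 * ‖z‖ ^ 2) * h2 + hkk'
    rw [this] at h7
    have := nonneg_of_mul_nonneg_right h7 (by positivity)
    linarith
  calc _ ≤ √(k : ℝ) ^ k * Real.exp (√2 * ‖z‖ * √k) := h5
    _ ≤ (Real.exp k * √(k.factorial : ℝ)) * Real.exp (k * (1 / (2 * ε)) + ε * ‖z‖ ^ 2) := by
        gcongr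
    _ = _ := by
        rw [mul_right_comm, ← Real.exp_add]
        ring_nf

/-! ### Multi-index series and rapidly decaying coefficients -/

/-- The product of convergent series indexed by multi-indices. -/
theorem hasSum_prod_pi : ∀ {n : ℕ} {f : Fin n → ℕ → ℂ} {a : Fin n → ℂ},
    (∀ j, HasSum (f j) (a j)) → (∀ j, Summable fun k => ‖f j k‖) →
    HasSum (fun α : Fin n → ℕ => ∏ j, f j (α j)) (∏ j, a j) ∧
      Summable fun α : Fin n → ℕ => ‖∏ j, f j (α j)‖ := by
  intro n
  induction n with
  | zero =>
    intro f a _ _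
    have h : HasSum (fun α : Fin 0 → ℕ => ∏ j, f j (α j)) (∏ j, a j) := by
      simp
    exact ⟨h, h.summable.norm⟩
  | succ n ih =>
    intro f a hf hs
    obtain ⟨h1, h2⟩ := ih (f := fun j => f j.succ) (fun j => hf j.succ) (fun j => hs j.succ)
    have h3 := summable_mul_of_summable_norm (hs 0) h2
    have h4 := (hf 0).mul h1 h3
    have h5 : Summable fun p : ℕ × (Fin n → ℕ) => ‖f 0 p.1 * ∏ j, f j.succ (p.2 j)‖ :=
      h3.norm
    have e : ∀ p : ℕ × (Fin n → ℕ), ∏ j, f j (Fin.consEquiv (fun _ => ℕ) p j) =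
        f 0 p.1 * ∏ j, f j.succ (p.2 j) := fun p => by
      rw [Fin.prod_univ_succ]; simp [Fin.consEquiv]
    constructor
    · rw [← (Fin.consEquiv (fun _ => ℕ)).hasSum_iff, Fin.prod_univ_succ]
      simpa only [Function.comp_def, e] using h4
    · rw [← (Fin.consEquiv (fun _ => ℕ)).summable_iff]
      simpa only [Function.comp_def, e] using h5

/-- The length `|α|` of a multi-index. -/
def multiDegree {n : ℕ} (α : Fin n → ℕ) : ℕ := ∑ j, α j

theorem summable_pow_multiDegree {n : ℕ} {ρ : ℝ} (h0 : 0 ≤ ρ) (h1 : ρ < 1) :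
    Summable fun α : Fin n → ℕ => ρ ^ multiDegree α := by
  have h : Summable fun k : ℕ => (ρ : ℂ) ^ k :=
    summable_geometric_of_norm_lt_one (by rwa [Complex.norm_real, Real.norm_of_nonneg h0])
  have := (hasSum_prod_pi (n := n) (f := fun _ k => (ρ : ℂ) ^ k) (fun _ => h.hasSum)
    (fun _ => h.norm)).2
  simpa [Finset.prod_pow_eq_pow_sum, multiDegree, abs_of_nonneg h0] using this

/-- Coefficient families that decay faster than every geometric sequence. -/
def RapidDecay {n : ℕ} (c : (Fin n → ℕ) → ℂ) : Prop :=
  ∀ T : ℝ, 0 ≤ T → Summable fun α => ‖c α‖ * T ^ multiDegree α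

/-- A bound at the larger ratio `2(T+1)` leaves a spare factor `2^{-|α|}`, which is summable over
multi-indices. -/
theorem rapidDecay_of_bound {n : ℕ} {c : (Fin n → ℕ) → ℂ}
    (h : ∀ T : ℝ, 1 ≤ T → ∃ C, ∀ α, ‖c α‖ * T ^ multiDegree α ≤ C) : RapidDecay c := by
  intro T hT
  obtain ⟨C, hC⟩ := h (2 * (T + 1)) (by linarith)
  refine Summable.of_nonneg_of_le (fun α => by positivity) (fun α => ?_)
    ((summable_pow_multiDegree (n := n) (ρ := 1 / 2) (by norm_num) (by norm_num)).mul_left C)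
  have := mul_le_mul_of_nonneg_right (hC α)
    (show (0 : ℝ) ≤ (1 / 2) ^ multiDegree α by positivity)
  refine le_trans ?_ this
  rw [mul_assoc, ← mul_pow]
  gcongr
  linarith

theorem RapidDecay.mono {n : ℕ} {c d : (Fin n → ℕ) → ℂ} (hc : RapidDecay c) {A B : ℝ} (hB : 0 ≤ B)
    (h : ∀ α, ‖d α‖ ≤ A * (‖c α‖ * B ^ multiDegree α)) : RapidDecay d := by
  intro T hT
  refine Summable.of_nonneg_of_le (fun α => by positivity) (fun α => ?_)
    ((hc (B * T) (by positivity)).mul_left A)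
  refine (mul_le_mul_of_nonneg_right (h α) (by positivity)).trans_eq ?_
  rw [mul_pow]; ring

/-- A series of entire functions growing at most geometrically, with rapidly decaying
coefficients, has an entire sum. -/
theorem differentiable_tsum_of_rapidDecay {n : ℕ} {E : Type*} [NormedAddCommGroup E]
    [NormedSpace ℂ E] {c : (Fin n → ℕ) → ℂ} (hc : RapidDecay c)
    {h : (Fin n → ℕ) → E → ℂ} (hd : ∀ α, Differentiable ℂ (h α))
    (hb : ∀ R : ℝ, ∃ D B : ℝ, 0 ≤ B ∧ ∀ α z, ‖z‖ ≤ R → ‖h α z‖ ≤ D * B ^ multiDegree α) :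
    Differentiable ℂ fun z => ∑' α, c α * h α z := by
  intro z₀
  -- The radius `‖z₀‖ + 2` contains the unit ball about each point of the unit ball about `z₀`, so
  -- Cauchy's estimate bounds the derivatives of the terms uniformly there.
  obtain ⟨D, B, hB, hDB⟩ := hb (‖z₀‖ + 2)
  set s := Metric.ball z₀ 1
  have hu : Summable fun α => 2 * D * (‖c α‖ * B ^ multiDegree α) := (hc B hB).mul_left _
  have hz₀ : z₀ ∈ s := Metric.mem_ball_self one_pos
  let _ : NormedSpace ℝ E := NormedSpace.restrictScalars ℝ ℂ E
  have hball : ∀ x ∈ s, ∀ y ∈ Metric.ball x 1, ‖y‖ ≤ ‖z₀‖ + 2 := by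
    intro x hx y hy
    rw [Metric.mem_ball, dist_eq_norm] at hx hy
    calc ‖y‖ = ‖(y - x) + (x - z₀) + z₀‖ := by congr 1; abel
      _ ≤ ‖y - x‖ + ‖x - z₀‖ + ‖z₀‖ := norm_add₃_le
      _ ≤ _ := by linarith
  refine (hasFDerivAt_tsum_of_isPreconnected (𝕜 := ℂ) (f := fun α z => c α * h α z)
    (f' := fun α z => c α • fderiv ℂ (h α) z) hu Metric.isOpen_ball
    (convex_ball z₀ 1).isPreconnected ?_ ?_ hz₀ ?_ hz₀).differentiableAt
  · intro α x _
    exact (hd α x).hasFDerivAt.const_mul (c α)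
  · intro α x hx
    have hf : ‖fderiv ℂ (h α) x‖ ≤ (2 * (D * B ^ multiDegree α)) / 1 := by
      refine Complex.norm_fderiv_le_div_of_mapsTo_ball (hd α).differentiableOn ?_ one_pos
      intro y hy
      rw [Metric.mem_closedBall, dist_eq_norm]
      refine (norm_sub_le _ _).trans ?_
      linarith [hDB α y (hball x hx y hy), hDB α x (hball x hx x (Metric.mem_ball_self one_pos))]
    rw [norm_smul]
    refine (mul_le_mul_of_nonneg_left hf (norm_nonneg _)).trans_eq ?_
    ring
  · refine Summable.of_norm_bounded (g := fun α => D * (‖c α‖ * B ^ multiDegree α))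
      ((hc B hB).mul_left _) (fun α => ?_)
    rw [norm_mul]
    refine (mul_le_mul_of_nonneg_left (hDB α z₀ (by linarith)) (norm_nonneg _)).trans_eq ?_
    ring

/-! ### Cauchy's inequality and uniqueness of power series coefficients -/

theorem integral_fourier_mul_fourier {n : ℕ} (β α : Fin n → ℤ) :
    ∫ t : Fin n → UnitAddCircle, (∏ j, fourier (-β j) (t j)) * ∏ j, fourier (α j) (t j)
      ∂(Measure.pi fun _ => AddCircle.haarAddCircle) = if α = β then 1 else 0 := by
  have h1 : ∀ a b : ℤ, ∫ t : UnitAddCircle, fourier (-b) t * fourier a t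
      ∂AddCircle.haarAddCircle = if a = b then 1 else 0 := fun a b => by
    have := congrFun (fourierCoeff_fourier (T := 1) a) b
    simp only [fourierCoeff, smul_eq_mul, Pi.single_apply] at this
    rw [this]
    simp [eq_comm]
  simp_rw [← Finset.prod_mul_distrib]
  rw [integral_fintype_prod_eq_prod (fun j (t : UnitAddCircle) =>
    fourier (-β j) t * fourier (α j) t)]
  simp_rw [h1]
  split_ifs with h
  · subst h; simp
  · obtain ⟨j, hj⟩ := Function.ne_iff.mp h
    exact Finset.prod_eq_zero (Finset.mem_univ j) (by simp [hj])

/-- Cauchy's inequality for a power series in several variables on a polycircle. -/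
theorem norm_coeff_le_of_norm_tsum_le {n : ℕ} {b : (Fin n → ℕ) → ℂ} {r : ℝ} (hr : 0 < r)
    (hs : Summable fun α => ‖b α‖ * r ^ multiDegree α) {M : ℝ}
    (hM : ∀ z : Fin n → ℂ, (∀ j, ‖z j‖ = r) → ‖∑' α, b α * ∏ j, z j ^ α j‖ ≤ M)
    (β : Fin n → ℕ) : ‖b β‖ * r ^ multiDegree β ≤ M := by
  set μ : Measure (Fin n → UnitAddCircle) := Measure.pi fun _ => AddCircle.haarAddCircle
  let z : (Fin n → UnitAddCircle) → Fin n → ℂ := fun t j => r * fourier 1 (t j)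
  -- Integrating the series over the torus against this conjugate character isolates the coefficient
  -- of index `β`.
  let E : (Fin n → UnitAddCircle) → ℂ := fun t => ∏ j, fourier (-(β j : ℤ)) (t j)
  have nE : ∀ t, ‖E t‖ = 1 := fun t => by
    simp only [E, norm_prod]
    exact Finset.prod_eq_one fun j _ => Circle.norm_coe _
  have nz : ∀ t j, ‖z t j‖ = r := fun t j => by
    rw [norm_mul, Complex.norm_real, Real.norm_of_nonneg hr.le, fourier_apply, Circle.norm_coe,
      mul_one]
  have hz : ∀ α t, ∏ j, z t j ^ α j = r ^ multiDegree α * ∏ j, fourier (α j : ℤ) (t j) := by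
    intro α t
    simp only [z, mul_pow, Finset.prod_mul_distrib, Finset.prod_pow_eq_pow_sum, multiDegree]
    congr 1
    refine Finset.prod_congr rfl fun j _ => ?_
    simp only [fourier_apply, one_smul]
    rw [← Circle.coe_pow, ← AddCircle.toCircle_nsmul, natCast_zsmul]
  have cE : ∀ β : Fin n → ℤ, Continuous fun t : Fin n → UnitAddCircle => ∏ j, fourier (β j) (t j) :=
    fun β => by fun_prop
  let G : (Fin n → ℕ) → (Fin n → UnitAddCircle) → ℂ := fun α t => E t * (b α * ∏ j, z t j ^ α j)
  have nG : ∀ α t, ‖G α t‖ = ‖b α‖ * r ^ multiDegree α := by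
    intro α t
    simp [G, nE, nz, Finset.prod_pow_eq_pow_sum, multiDegree]
  have hG : ∀ α, G α = fun t => (b α * r ^ multiDegree α) *
      ((∏ j, fourier (-(β j : ℤ)) (t j)) * ∏ j, fourier (α j : ℤ) (t j)) := by
    intro α; ext t; simp only [G, E, hz]; ring
  have iG : ∀ α, Integrable (G α) μ := by
    intro α
    refine Integrable.of_bound (C := ‖b α‖ * r ^ multiDegree α) ?_
      (Eventually.of_forall fun t => (nG α t).le)
    rw [hG]
    exact (continuous_const.mul ((cE _).mul (cE _))).aestronglyMeasurable
  have vG : ∀ α, ∫ t, G α t ∂μ = if α = β then b β * r ^ multiDegree β else 0 := by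
    intro α
    rw [hG, integral_const_mul, integral_fourier_mul_fourier (fun j => (β j : ℤ))]
    have : ((fun j => (α j : ℤ)) = fun j => (β j : ℤ)) ↔ α = β := by
      simp [funext_iff]
    simp only [this]
    split_ifs with h
    · rw [h, mul_one]
    · rw [mul_zero]
  have h1 := hasSum_integral_of_summable_integral_norm iG (by simpa [nG] using hs)
  simp_rw [vG] at h1
  have h2 := h1.unique (hasSum_ite_eq β _)
  have h3 : ‖∫ t, ∑' α, G α t ∂μ‖ ≤ M * μ.real Set.univ := by
    refine norm_integral_le_of_norm_le_const (Eventually.of_forall fun t => ?_)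
    simp only [G, tsum_mul_left, norm_mul, nE, one_mul]
    exact hM _ (nz t)
  rw [h2] at h3
  simpa [abs_of_pos hr] using h3

theorem RapidDecay.coeff_eq_zero {n : ℕ} {b : (Fin n → ℕ) → ℂ} (hb : RapidDecay b)
    (h : ∀ z : Fin n → ℂ, ∑' α, b α * ∏ j, z j ^ α j = 0) : b = 0 := by
  ext β
  have := norm_coeff_le_of_norm_tsum_le one_pos (hb 1 zero_le_one) (M := 0)
    (fun z _ => by simp [h z]) β
  simpa using this

theorem norm_prod_pow_le {n : ℕ} {z : Fin n → ℂ} {r : ℝ} (hz : ∀ j, ‖z j‖ ≤ r) (α : Fin n → ℕ) :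
    ‖∏ j, z j ^ α j‖ ≤ r ^ multiDegree α := by
  rw [norm_prod, multiDegree, ← Finset.prod_pow_eq_pow_sum]
  refine Finset.prod_le_prod (fun _ _ => norm_nonneg _) fun j _ => ?_
  rw [norm_pow]
  exact pow_le_pow_left₀ (norm_nonneg _) (hz j) _

theorem RapidDecay.summable_mul_prod_pow {n : ℕ} {b : (Fin n → ℕ) → ℂ} (hb : RapidDecay b)
    (z : Fin n → ℂ) : Summable fun α => b α * ∏ j, z j ^ α j := by
  refine Summable.of_norm_bounded (hb (∑ j, ‖z j‖) (by positivity)) fun α => ?_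
  rw [norm_mul]
  gcongr
  exact norm_prod_pow_le (fun j => Finset.single_le_sum (f := fun j => ‖z j‖)
    (fun _ _ => norm_nonneg _) (Finset.mem_univ j)) α

/-- The coefficients of an everywhere convergent power series are unique. -/
theorem RapidDecay.coeff_unique {n : ℕ} {b c : (Fin n → ℕ) → ℂ} (hb : RapidDecay b)
    (hc : RapidDecay c)
    (h : ∀ z : Fin n → ℂ, ∑' α, b α * ∏ j, z j ^ α j = ∑' α, c α * ∏ j, z j ^ α j) : b = c := by
  have hd : RapidDecay (b - c) := by
    intro T hT
    refine Summable.of_nonneg_of_le (fun α => by positivity) (fun α => ?_) ((hb T hT).add (hc T hT))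
    rw [← add_mul]
    gcongr
    exact norm_sub_le _ _
  rw [← sub_eq_zero]
  refine hd.coeff_eq_zero fun z => ?_
  simp only [Pi.sub_apply, sub_mul]
  rw [Summable.tsum_sub (hb.summable_mul_prod_pow z) (hc.summable_mul_prod_pow z), h z, sub_self]

/-! ### Generating function and the Bargmann kernel -/

theorem iteratedDeriv_exp_hermite (x : ℂ) (k : ℕ) :
    iteratedDeriv k (fun w : ℂ => Complex.exp (x * w - w ^ 2 / 2)) =
      fun w => Polynomial.aeval (x - w) (Polynomial.hermite k) *
        Complex.exp (x * w - w ^ 2 / 2) := by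
  induction k with
  | zero => simp
  | succ k ih =>
    rw [iteratedDeriv_succ, ih]
    ext w
    have h1 : HasDerivAt (fun w : ℂ => Complex.exp (x * w - w ^ 2 / 2))
        (Complex.exp (x * w - w ^ 2 / 2) * (x - w)) w := by
      have : HasDerivAt (fun w : ℂ => x * w - w ^ 2 / 2) (x - w) w := by
        convert! ((hasDerivAt_id w).const_mul x).sub (((hasDerivAt_id w).pow 2).div_const 2) using 1
        simp
      exact this.cexp
    have h2 : HasDerivAt (fun w : ℂ => Polynomial.aeval (x - w) (Polynomial.hermite k))
        (-Polynomial.aeval (x - w) (Polynomial.derivative (Polynomial.hermite k))) w := by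
      have := (Polynomial.hasDerivAt_aeval (Polynomial.hermite k) (x - w)).comp w
        ((hasDerivAt_id w).const_sub x)
      convert! this using 1
      simp
    rw [(h2.fun_mul h1).deriv, Polynomial.hermite_succ]
    simp only [map_sub, map_mul, Polynomial.aeval_X]
    ring

/-- The generating function of the Hermite polynomials. -/
theorem hasSum_hermite_generating (x w : ℂ) :
    HasSum (fun k : ℕ => w ^ k / k.factorial * Polynomial.aeval x (Polynomial.hermite k))
      (Complex.exp (x * w - w ^ 2 / 2)) := by
  have hd : Differentiable ℂ fun w : ℂ => Complex.exp (x * w - w ^ 2 / 2) := by fun_prop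
  have := Complex.hasSum_taylorSeries_of_entire hd 0 w
  simp only [iteratedDeriv_exp_hermite, smul_eq_mul] at this
  refine this.congr_fun fun k => ?_
  simp
  ring

/-- The kernel of the Bargmann transform on `ℝ` (without normalizing constant). -/
def bargmannKernelOne (z x : ℂ) : ℂ := Complex.exp (-z ^ 2 / 2 + √2 * x * z - x ^ 2 / 2)

theorem hasSum_bargmannKernelOne (z : ℂ) (x : ℝ) :
    HasSum (fun k : ℕ => ((√√Real.pi / √(k.factorial : ℝ) : ℝ) : ℂ) * z ^ k * hermiteFun k x)
      (bargmannKernelOne z x) := by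
  have h := (hasSum_hermite_generating (√2 * x) z).mul_right (Complex.exp (-(x : ℂ) ^ 2 / 2))
  rw [← Complex.exp_add] at h
  convert! h using 1
  · ext k
    rw [hermiteFun_eq, hermitePoly]
    have hf : (0 : ℝ) < k.factorial := by exact_mod_cast k.factorial_pos
    have e : (√√Real.pi / √(k.factorial : ℝ)) * (√(k.factorial * √Real.pi))⁻¹ =
        (k.factorial : ℝ)⁻¹ := by
      rw [Real.sqrt_mul hf.le]
      have h1 : √√Real.pi ≠ 0 := by positivity
      have h2 : √(k.factorial : ℝ) * √(k.factorial : ℝ) = k.factorial := Real.mul_self_sqrt hf.le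
      refine eq_inv_of_mul_eq_one_left ?_
      field_simp
      linear_combination -h2
    have e' : (((√√Real.pi / √(k.factorial : ℝ)) : ℝ) : ℂ) * ((√(k.factorial * √Real.pi))⁻¹ : ℝ) =
        (k.factorial : ℂ)⁻¹ := by
      rw [← Complex.ofReal_mul, e]; simp
    linear_combination (z ^ k * (Polynomial.aeval ((√2 : ℂ) * x) (Polynomial.hermite k)) *
      Complex.exp (-(x : ℂ) ^ 2 / 2)) * e'
  · rw [bargmannKernelOne]; ring_nf

/-- The kernel of the Bargmann transform on `ℝⁿ` (without normalizing constant). -/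
def bargmannKernel {n : ℕ} (z : Fin n → ℂ) (x : EuclideanSpace ℝ (Fin n)) : ℂ :=
  ∏ j, bargmannKernelOne (z j) (x j)

/-- The Taylor coefficients of the Bargmann transform of the Hermite functions. -/
def bargmannCoeff {n : ℕ} (α : Fin n → ℕ) : ℝ := ∏ j, √√Real.pi / √((α j).factorial : ℝ)

theorem bargmannCoeff_pos {n : ℕ} (α : Fin n → ℕ) : 0 < bargmannCoeff α :=
  Finset.prod_pos fun j _ => by
    have : (0 : ℝ) < (α j).factorial := by exact_mod_cast (α j).factorial_pos
    positivity

theorem hasSum_bargmannKernel {n : ℕ} (z : Fin n → ℂ) (x : EuclideanSpace ℝ (Fin n)) :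
    HasSum (fun α : Fin n → ℕ => (bargmannCoeff α : ℂ) * (∏ j, z j ^ α j) * hermiteFunction α x)
      (bargmannKernel z x) := by
  have := (hasSum_prod_pi (fun j => hasSum_bargmannKernelOne (z j) (x j))
    (fun j => (hasSum_bargmannKernelOne (z j) (x j)).summable.norm)).1
  refine this.congr_fun fun α => ?_
  simp only [bargmannCoeff, hermiteFunction, Finset.prod_mul_distrib, Complex.ofReal_prod]

/-- Each term is the product of `(2|T|)^k/√k!` and `2^{-k}`, hence at most the sum of their squares,
and both series of squares converge. -/
theorem summable_pow_div_sqrt_factorial (T : ℝ) :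
    Summable fun k : ℕ => |T| ^ k / √(k.factorial : ℝ) := by
  have h1 : Summable fun k : ℕ => (4 * T ^ 2) ^ k / (k.factorial : ℝ) :=
    Real.summable_pow_div_factorial _
  have h2 : Summable fun k : ℕ => (1 / 4 : ℝ) ^ k :=
    summable_geometric_of_lt_one (by norm_num) (by norm_num)
  refine Summable.of_nonneg_of_le (fun k => by positivity) (fun k => ?_) (h1.add h2)
  have hf : (0 : ℝ) < k.factorial := by exact_mod_cast k.factorial_pos
  have hs : √(k.factorial : ℝ) ^ 2 = k.factorial := Real.sq_sqrt hf.le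
  have e1 : (4 * T ^ 2) ^ k / (k.factorial : ℝ) = ((2 * |T|) ^ k / √(k.factorial : ℝ)) ^ 2 := by
    rw [div_pow, hs, ← pow_mul, mul_comm k 2, pow_mul, mul_pow 2 |T|, sq_abs]; norm_num
  have e2 : (1 / 4 : ℝ) ^ k = ((1 / 2 : ℝ) ^ k) ^ 2 := by
    rw [← pow_mul, mul_comm k 2, pow_mul]; norm_num
  have e3 : |T| ^ k / √(k.factorial : ℝ) =
      (2 * |T|) ^ k / √(k.factorial : ℝ) * (1 / 2 : ℝ) ^ k := by
    rw [div_mul_eq_mul_div, ← mul_pow]; congr 2; ring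
  rw [e1, e2, e3]
  nlinarith [sq_nonneg ((2 * |T|) ^ k / √(k.factorial : ℝ) - (1 / 2 : ℝ) ^ k),
    sq_nonneg ((2 * |T|) ^ k / √(k.factorial : ℝ) + (1 / 2 : ℝ) ^ k)]

theorem rapidDecay_bargmannCoeff {n : ℕ} : RapidDecay fun α : Fin n → ℕ => (bargmannCoeff α : ℂ) := by
  intro T hT
  have h1 : Summable fun k : ℕ => ((√√Real.pi / √(k.factorial : ℝ) * T ^ k : ℝ) : ℂ) := by
    refine Complex.summable_ofReal.2 ?_
    refine ((summable_pow_div_sqrt_factorial T).mul_left (√√Real.pi)).congr fun k => ?_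
    rw [abs_of_nonneg hT]; ring
  refine (hasSum_prod_pi (n := n) (fun _ => h1.hasSum) (fun _ => h1.norm)).2.congr fun α => ?_
  rw [← Complex.ofReal_prod, Complex.norm_real, Complex.norm_real, Finset.prod_mul_distrib,
    Finset.prod_pow_eq_pow_sum, norm_mul, bargmannCoeff, multiDegree, norm_pow,
    Real.norm_of_nonneg hT]

/-! ### Hermite functions in several variables and Gaussian bounds -/

/-- The polynomial factor of the Hermite function `Φ_α`, as a function on `ℂⁿ`. -/
def hermitePolyMulti {n : ℕ} (α : Fin n → ℕ) (z : EuclideanSpace ℂ (Fin n)) : ℂ :=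
  ∏ j, hermitePoly (α j) (z j)

@[simp]
theorem realToComplex_apply {n : ℕ} (x : EuclideanSpace ℝ (Fin n)) (j : Fin n) :
    realToComplex x j = x j := rfl

theorem norm_realToComplex {n : ℕ} (x : EuclideanSpace ℝ (Fin n)) : ‖realToComplex x‖ = ‖x‖ := by
  simp [EuclideanSpace.norm_eq]

theorem continuous_realToComplex {n : ℕ} :
    Continuous (realToComplex : EuclideanSpace ℝ (Fin n) → EuclideanSpace ℂ (Fin n)) := by
  unfold realToComplex
  fun_prop

theorem sum_ofReal_sq {n : ℕ} (x : EuclideanSpace ℝ (Fin n)) :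
    ∑ j, (x j : ℂ) ^ 2 = (‖x‖ : ℂ) ^ 2 := by
  rw [← Complex.ofReal_pow, EuclideanSpace.real_norm_sq_eq]; push_cast; rfl

theorem hermiteFunction_eq {n : ℕ} (α : Fin n → ℕ) (x : EuclideanSpace ℝ (Fin n)) :
    (hermiteFunction α x : ℂ) =
      hermitePolyMulti α (realToComplex x) * Complex.exp (-(‖x‖ : ℂ) ^ 2 / 2) := by
  rw [hermiteFunction, hermitePolyMulti, Complex.ofReal_prod]
  simp only [hermiteFun_eq, Finset.prod_mul_distrib, realToComplex_apply]
  rw [← Complex.exp_sum, ← Finset.sum_div, Finset.sum_neg_distrib, sum_ofReal_sq]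

theorem differentiable_hermitePoly (k : ℕ) : Differentiable ℂ (hermitePoly k) := by
  unfold hermitePoly
  have h : Differentiable ℂ fun z : ℂ => Polynomial.aeval z (Polynomial.hermite k) :=
    fun z => (Polynomial.hasDerivAt_aeval (Polynomial.hermite k) z).differentiableAt
  exact (h.comp (differentiable_id.const_mul (√2 : ℂ))).const_mul _

theorem differentiable_hermitePolyMulti {n : ℕ} (α : Fin n → ℕ) :
    Differentiable ℂ (hermitePolyMulti α) := by
  unfold hermitePolyMulti
  have h : ∀ j, Differentiable ℂ fun z : EuclideanSpace ℂ (Fin n) => hermitePoly (α j) (z j) :=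
    fun j => (differentiable_hermitePoly _).comp (by fun_prop)
  fun_prop

theorem exists_norm_hermitePolyMulti_le (n : ℕ) {ε : ℝ} (hε : 0 < ε) :
    ∃ B : ℝ, 1 ≤ B ∧ ∀ (α : Fin n → ℕ) z,
      ‖hermitePolyMulti α z‖ ≤ B ^ multiDegree α * Real.exp (ε * ‖z‖ ^ 2) := by
  obtain ⟨B, hB, h⟩ := exists_norm_hermitePoly_le hε
  refine ⟨B, hB, fun α z => ?_⟩
  rw [hermitePolyMulti, norm_prod, EuclideanSpace.norm_sq_eq, Finset.mul_sum, Real.exp_sum,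
    multiDegree, ← Finset.prod_pow_eq_pow_sum, ← Finset.prod_mul_distrib]
  exact Finset.prod_le_prod (fun _ _ => norm_nonneg _) fun j _ => h _ _

theorem exists_hermiteFunction_le (n : ℕ) :
    ∃ B : ℝ, 1 ≤ B ∧ ∀ (α : Fin n → ℕ) x,
      ‖(hermiteFunction α x : ℂ)‖ ≤ B ^ multiDegree α * Real.exp (-(1 / 4) * ‖x‖ ^ 2) := by
  obtain ⟨B, hB, h⟩ := exists_norm_hermitePolyMulti_le n (show (0 : ℝ) < 1 / 4 by norm_num)
  refine ⟨B, hB, fun α x => ?_⟩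
  rw [hermiteFunction_eq, norm_mul, Complex.norm_exp]
  refine (mul_le_mul_of_nonneg_right (h α _) (Real.exp_pos _).le).trans_eq ?_
  rw [mul_assoc, ← Real.exp_add, norm_realToComplex]
  congr 2
  have : (-(‖x‖ : ℂ) ^ 2 / 2).re = -‖x‖ ^ 2 / 2 := by
    rw [show (-(‖x‖ : ℂ) ^ 2 / 2) = ((-‖x‖ ^ 2 / 2 : ℝ) : ℂ) by push_cast; rfl, Complex.ofReal_re]
  rw [this]; ring

theorem continuous_hermiteFunction {n : ℕ} (α : Fin n → ℕ) :
    Continuous fun x : EuclideanSpace ℝ (Fin n) => (hermiteFunction α x : ℂ) := by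
  simp_rw [hermiteFunction_eq]
  exact ((differentiable_hermitePolyMulti α).continuous.comp continuous_realToComplex).mul
    (by fun_prop)

theorem integrable_exp_neg_mul_norm_sq (n : ℕ) {b : ℝ} (hb : 0 < b) :
    Integrable fun x : EuclideanSpace ℝ (Fin n) => Real.exp (-b * ‖x‖ ^ 2) := by
  have := (GaussianFourier.integrable_cexp_neg_mul_sq_norm_add (V := EuclideanSpace ℝ (Fin n))
    (b := (b : ℂ)) (by simpa) 0 0).norm
  refine this.congr (Eventually.of_forall fun x => ?_)
  simp [Complex.norm_exp, ← Complex.ofReal_pow]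

theorem memLp_exp_neg_mul_norm_sq (n : ℕ) {b : ℝ} (hb : 0 < b) :
    MemLp (fun x : EuclideanSpace ℝ (Fin n) => Real.exp (-b * ‖x‖ ^ 2)) 2 := by
  rw [memLp_two_iff_integrable_sq (by fun_prop)]
  refine (integrable_exp_neg_mul_norm_sq n (b := 2 * b) (by positivity)).congr
    (Eventually.of_forall fun x => ?_)
  simp only
  rw [← Real.exp_nat_mul]; congr 1; push_cast; ring

theorem memLp_hermiteFunction {n : ℕ} (α : Fin n → ℕ) :
    MemLp (fun x : EuclideanSpace ℝ (Fin n) => (hermiteFunction α x : ℂ)) 2 := by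
  obtain ⟨B, hB, h⟩ := exists_hermiteFunction_le n
  refine MemLp.of_le_mul (memLp_exp_neg_mul_norm_sq n (b := 1 / 4) (by norm_num))
    (continuous_hermiteFunction α).aestronglyMeasurable (c := B ^ multiDegree α)
    (Eventually.of_forall fun x => ?_)
  rw [Real.norm_of_nonneg (Real.exp_pos _).le]
  exact h α x

theorem integrable_hermiteFunction {n : ℕ} (α : Fin n → ℕ) :
    Integrable (fun x : EuclideanSpace ℝ (Fin n) => (hermiteFunction α x : ℂ)) := by
  obtain ⟨B, hB, h⟩ := exists_hermiteFunction_le n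
  refine Integrable.mono' ((integrable_exp_neg_mul_norm_sq n (b := 1 / 4) (by norm_num)).const_mul
    (B ^ multiDegree α)) (continuous_hermiteFunction α).aestronglyMeasurable
    (Eventually.of_forall fun x => h α x)

/-! ### The Bargmann transform as a power series in the Hermite coefficients -/

/-- The functions that are integrable against a wide Gaussian. -/
def GaussIntegrable {n : ℕ} (f : EuclideanSpace ℝ (Fin n) → ℂ) : Prop :=
  Integrable fun x => f x * (Real.exp (-(1 / 4) * ‖x‖ ^ 2) : ℂ)

theorem gaussIntegrable_of_integrable {n : ℕ} {f : EuclideanSpace ℝ (Fin n) → ℂ}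
    (hf : Integrable f) : GaussIntegrable f := by
  refine hf.mono (hf.1.mul (by fun_prop)) (Eventually.of_forall fun x => ?_)
  rw [norm_mul, Complex.norm_real, Real.norm_of_nonneg (Real.exp_pos _).le]
  exact mul_le_of_le_one_right (norm_nonneg _) (Real.exp_le_one_iff.2 (by nlinarith [sq_nonneg ‖x‖]))

theorem gaussIntegrable_of_bound {n : ℕ} {f : EuclideanSpace ℝ (Fin n) → ℂ} (hc : Continuous f)
    {C : ℝ} (hf : ∀ x, ‖f x‖ ≤ C) : GaussIntegrable f :=
  (integrable_exp_neg_mul_norm_sq n (b := 1 / 4) (by norm_num)).ofReal.bdd_mul (c := C)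
    hc.aestronglyMeasurable (Eventually.of_forall hf)

theorem GaussIntegrable.exists_integral_le {n : ℕ} {f : EuclideanSpace ℝ (Fin n) → ℂ}
    (hf : GaussIntegrable f) : ∃ D B : ℝ, 0 ≤ D ∧ 1 ≤ B ∧ ∀ α,
      Integrable (fun x => f x * (hermiteFunction α x : ℂ)) ∧
      ∫ x, ‖f x * (hermiteFunction α x : ℂ)‖ ≤ D * B ^ multiDegree α := by
  obtain ⟨B, hB, h⟩ := exists_hermiteFunction_le n
  refine ⟨∫ x, ‖f x * (Real.exp (-(1 / 4) * ‖x‖ ^ 2) : ℂ)‖, B,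
    integral_nonneg fun _ => norm_nonneg _, hB, fun α => ?_⟩
  have hle : ∀ x, ‖f x * (hermiteFunction α x : ℂ)‖ ≤
      ‖f x * (Real.exp (-(1 / 4) * ‖x‖ ^ 2) : ℂ)‖ * B ^ multiDegree α := fun x => by
    rw [norm_mul, norm_mul, Complex.norm_real (Real.exp _), Real.norm_of_nonneg (Real.exp_pos _).le]
    refine (mul_le_mul_of_nonneg_left (h α x) (norm_nonneg _)).trans_eq ?_
    ring
  have hm : AEStronglyMeasurable f := by
    have : f = fun x => (f x * (Real.exp (-(1 / 4) * ‖x‖ ^ 2) : ℂ)) *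
        (Real.exp ((1 / 4) * ‖x‖ ^ 2) : ℂ) := by
      ext x
      rw [mul_assoc, ← Complex.ofReal_mul, ← Real.exp_add]; simp
    rw [this]
    exact hf.1.mul (by fun_prop)
  have hi : Integrable (fun x => f x * (hermiteFunction α x : ℂ)) :=
    (Integrable.norm hf |>.mul_const _).mono' (hm.mul (continuous_hermiteFunction α).aestronglyMeasurable)
      (Eventually.of_forall hle)
  refine ⟨hi, ?_⟩
  rw [← integral_mul_const]
  exact integral_mono hi.norm (Integrable.norm hf |>.mul_const _) hle

/-- The Bargmann transform (up to a constant factor). -/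
def bargmann {n : ℕ} (f : EuclideanSpace ℝ (Fin n) → ℂ) (z : Fin n → ℂ) : ℂ :=
  ∫ x, f x * bargmannKernel z x

theorem GaussIntegrable.rapidDecay {n : ℕ} {f : EuclideanSpace ℝ (Fin n) → ℂ}
    (hf : GaussIntegrable f) : RapidDecay fun α => (bargmannCoeff α : ℂ) * hermiteCoeff f α := by
  obtain ⟨D, B, hD, hB, h⟩ := hf.exists_integral_le
  refine rapidDecay_bargmannCoeff.mono (A := D) (B := B) (by linarith) fun α => ?_
  rw [norm_mul]
  have := (norm_integral_le_integral_norm _).trans (h α).2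
  refine (mul_le_mul_of_nonneg_left this (norm_nonneg _)).trans_eq ?_
  ring

theorem GaussIntegrable.bargmann_eq {n : ℕ} {f : EuclideanSpace ℝ (Fin n) → ℂ}
    (hf : GaussIntegrable f) (z : Fin n → ℂ) :
    bargmann f z = ∑' α, ((bargmannCoeff α : ℂ) * hermiteCoeff f α) * ∏ j, z j ^ α j := by
  obtain ⟨D, B, hD, hB, h⟩ := hf.exists_integral_le
  have hF : ∀ α, (fun x => f x * ((bargmannCoeff α : ℂ) * (∏ j, z j ^ α j) *
      (hermiteFunction α x : ℂ))) = fun x => ((bargmannCoeff α : ℂ) * ∏ j, z j ^ α j) *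
      (f x * (hermiteFunction α x : ℂ)) := fun α => by ext x; ring
  have h1 := hasSum_integral_of_summable_integral_norm (μ := volume)
    (F := fun α x => f x * ((bargmannCoeff α : ℂ) * (∏ j, z j ^ α j) * (hermiteFunction α x : ℂ)))
    (fun α => by rw [hF]; exact (h α).1.const_mul _) ?_
  · rw [bargmann]
    have e : ∀ x, f x * bargmannKernel z x = ∑' α, f x * ((bargmannCoeff α : ℂ) *
        (∏ j, z j ^ α j) * (hermiteFunction α x : ℂ)) := fun x => by
      rw [tsum_mul_left, (hasSum_bargmannKernel z x).tsum_eq]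
    simp_rw [e]
    rw [← h1.tsum_eq]
    congr 1; ext α
    rw [hF, integral_const_mul, hermiteCoeff]
    ring
  · refine Summable.of_nonneg_of_le (fun α => integral_nonneg fun _ => norm_nonneg _) (fun α => ?_)
      ((rapidDecay_bargmannCoeff (n := n) ((∑ j, ‖z j‖) * B) (by positivity)).mul_left D)
    have hF' : ∀ x, f x * ((bargmannCoeff α : ℂ) * (∏ j, z j ^ α j) *
      (hermiteFunction α x : ℂ)) = ((bargmannCoeff α : ℂ) * ∏ j, z j ^ α j) *
      (f x * (hermiteFunction α x : ℂ)) := fun x => by ring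
    simp_rw [hF', norm_mul (_ * ∏ j, z j ^ α j)]
    rw [integral_const_mul, norm_mul, mul_pow]
    calc _ ≤ ‖(bargmannCoeff α : ℂ)‖ * (∑ j, ‖z j‖) ^ multiDegree α *
          (D * B ^ multiDegree α) := by
          gcongr
          · exact norm_prod_pow_le (fun j => Finset.single_le_sum (f := fun j => ‖z j‖)
              (fun _ _ => norm_nonneg _) (Finset.mem_univ j)) α
          · exact (h α).2
      _ = _ := by ring

/-- The Hermite coefficients are determined by the Bargmann transform. -/
theorem GaussIntegrable.hermiteCoeff_eq {n : ℕ} {f : EuclideanSpace ℝ (Fin n) → ℂ}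
    (hf : GaussIntegrable f) {b : (Fin n → ℕ) → ℂ}
    (hb : RapidDecay fun α => (bargmannCoeff α : ℂ) * b α)
    (h : ∀ z, bargmann f z = ∑' α, ((bargmannCoeff α : ℂ) * b α) * ∏ j, z j ^ α j) :
    hermiteCoeff f = b := by
  have := hf.rapidDecay.coeff_unique hb fun z => by rw [← hf.bargmann_eq, h]
  ext α
  exact mul_left_cancel₀ (Complex.ofReal_ne_zero.2 (bargmannCoeff_pos α).ne') (congrFun this α)

/-! ### Gaussian integrals of the kernel, orthonormality, Fourier characters -/

theorem integral_prod_euclideanSpace {n : ℕ} (f : Fin n → ℝ → ℂ) :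
    ∫ x : EuclideanSpace ℝ (Fin n), ∏ j, f j (x j) = ∏ j, ∫ t, f j t := by
  rw [← integral_fintype_prod_volume_eq_prod, ← (PiLp.volume_preserving_toLp (Fin n)).integral_comp
    (MeasurableEquiv.toLp 2 _).measurableEmbedding]

theorem integral_bargmannKernelOne_mul (z w : ℂ) :
    ∫ x : ℝ, bargmannKernelOne z x * bargmannKernelOne w x = √Real.pi * Complex.exp (z * w) := by
  have e : ∀ x : ℝ, bargmannKernelOne z x * bargmannKernelOne w x =
      Complex.exp ((-1) * (x : ℂ) ^ 2 + √2 * (z + w) * x + (-z ^ 2 / 2 - w ^ 2 / 2)) := fun x => by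
    rw [bargmannKernelOne, bargmannKernelOne, ← Complex.exp_add]; ring_nf
  simp_rw [e]
  rw [integral_cexp_quadratic (by simp)]
  have h2 : ((√2 : ℝ) : ℂ) ^ 2 = 2 := by rw [← Complex.ofReal_pow]; simp
  congr 1
  · rw [neg_neg, div_one, Real.sqrt_eq_rpow, Complex.ofReal_cpow Real.pi_pos.le]; simp
  · congr 1
    linear_combination (1 / 4 * (z + w) ^ 2) * h2

/-- Completing the square turns the `x`-integral into another kernel. This identity is the source of
the rotation `z ↦ -iz` by which the Fourier transform acts on the Bargmann side. -/
theorem integral_bargmannKernelOne_fourier (z : ℂ) (ξ : ℝ) :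
    ∫ x : ℝ, Complex.exp (-Complex.I * (x * ξ)) * bargmannKernelOne z x =
      √(2 * Real.pi) * bargmannKernelOne (-Complex.I * z) ξ := by
  have e : ∀ x : ℝ, Complex.exp (-Complex.I * (x * ξ)) * bargmannKernelOne z x =
      Complex.exp ((-1 / 2) * (x : ℂ) ^ 2 + (√2 * z - Complex.I * ξ) * x + (-z ^ 2 / 2)) := fun x => by
    rw [bargmannKernelOne, ← Complex.exp_add]; ring_nf
  simp_rw [e]
  rw [integral_cexp_quadratic (by norm_num)]
  have h2 : ((√2 : ℝ) : ℂ) ^ 2 = 2 := by rw [← Complex.ofReal_pow]; simp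
  congr 1
  · rw [Real.sqrt_eq_rpow, Complex.ofReal_cpow (by positivity)]
    congr 1
    · push_cast; ring
    · simp
  · rw [bargmannKernelOne]
    congr 1
    linear_combination (z ^ 2 / 2) * h2 + (ξ ^ 2 / 2 + z ^ 2 / 2) * Complex.I_sq

theorem integral_bargmannKernel_mul {n : ℕ} (z w : Fin n → ℂ) :
    ∫ x, bargmannKernel z x * bargmannKernel w x =
      ((√Real.pi : ℝ) : ℂ) ^ n * Complex.exp (∑ j, z j * w j) := by
  simp only [bargmannKernel, ← Finset.prod_mul_distrib]
  rw [integral_prod_euclideanSpace fun j (t : ℝ) => bargmannKernelOne (z j) t * bargmannKernelOne (w j) t]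
  simp_rw [integral_bargmannKernelOne_mul, Finset.prod_mul_distrib, Complex.exp_sum]
  simp

theorem inner_eq_sum_mul {n : ℕ} (x ξ : EuclideanSpace ℝ (Fin n)) :
    inner ℝ x ξ = ∑ j, x j * ξ j := by
  simp [PiLp.inner_apply, mul_comm]

theorem integral_bargmannKernel_fourier {n : ℕ} (z : Fin n → ℂ) (ξ : EuclideanSpace ℝ (Fin n)) :
    ∫ x, Complex.exp (-Complex.I * ((inner ℝ x ξ : ℝ) : ℂ)) * bargmannKernel z x =
      ((√(2 * Real.pi) : ℝ) : ℂ) ^ n * bargmannKernel (fun j => -Complex.I * z j) ξ := by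
  have e : ∀ x, Complex.exp (-Complex.I * ((inner ℝ x ξ : ℝ) : ℂ)) * bargmannKernel z x =
      ∏ j, (Complex.exp (-Complex.I * (x j * ξ j)) * bargmannKernelOne (z j) (x j)) := fun x => by
    rw [inner_eq_sum_mul, Complex.ofReal_sum, Finset.mul_sum, Complex.exp_sum, bargmannKernel,
      Finset.prod_mul_distrib]
    simp
  simp_rw [e]
  rw [integral_prod_euclideanSpace fun j (t : ℝ) =>
    Complex.exp (-Complex.I * (t * ξ j)) * bargmannKernelOne (z j) t]
  simp_rw [integral_bargmannKernelOne_fourier, Finset.prod_mul_distrib, bargmannKernel]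
  simp

theorem bargmannKernel_eq {n : ℕ} (z : Fin n → ℂ) (x : EuclideanSpace ℝ (Fin n)) :
    bargmannKernel z x =
      Complex.exp (-(∑ j, z j ^ 2) / 2 + √2 * ∑ j, (x j : ℂ) * z j - (‖x‖ : ℂ) ^ 2 / 2) := by
  rw [bargmannKernel, ← sum_ofReal_sq]
  simp only [bargmannKernelOne]
  rw [← Complex.exp_sum, Finset.sum_sub_distrib, Finset.sum_add_distrib, Finset.sum_div,
    Finset.mul_sum, ← Finset.sum_div, ← Finset.sum_div, Finset.sum_neg_distrib]
  simp only [mul_assoc, Finset.sum_div]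

theorem continuous_bargmannKernel {n : ℕ} (z : Fin n → ℂ) : Continuous (bargmannKernel z) := by
  unfold bargmannKernel bargmannKernelOne
  fun_prop

/-- The cross term `√2 x Re z` is split as `ηx² + (Re z)²/(2η)`. The closer `η` is to `1`, the
smaller the coefficient of `(Re z)²`, at the price of Gaussian growth in `x`. -/
theorem norm_bargmannKernelOne_le (z : ℂ) (x : ℝ) {η : ℝ} (hη : 0 < η) :
    ‖bargmannKernelOne z x‖ ≤
      Real.exp (z.im ^ 2 / 2 + (1 / (2 * η) - 1 / 2) * z.re ^ 2 - (1 / 2 - η) * x ^ 2) := by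
  rw [bargmannKernelOne, Complex.norm_exp, Real.exp_le_exp]
  have : (-z ^ 2 / 2 + √2 * x * z - (x : ℂ) ^ 2 / 2).re =
      -(z.re ^ 2 - z.im ^ 2) / 2 + √2 * x * z.re - x ^ 2 / 2 := by
    have h1 : (z ^ 2).re = z.re ^ 2 - z.im ^ 2 := by rw [sq, Complex.mul_re]; ring
    have h2 : ((x : ℂ) ^ 2).re = x ^ 2 := by rw [← Complex.ofReal_pow, Complex.ofReal_re]
    have h3 : ((√2 : ℂ) * x * z).re = √2 * x * z.re := by
      rw [← Complex.ofReal_mul, Complex.re_ofReal_mul]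
    simp [h1, h2, h3]
  rw [this]
  have h2 : √2 ^ 2 = (2 : ℝ) := by simp
  have h : √2 * x * z.re ≤ η * x ^ 2 + 1 / (2 * η) * z.re ^ 2 := by
    have h0 : 0 ≤ (√2 * η * x - z.re) ^ 2 / (2 * η) := by positivity
    have e : (√2 * η * x - z.re) ^ 2 / (2 * η) =
        η * x ^ 2 + 1 / (2 * η) * z.re ^ 2 - √2 * x * z.re := by
      field_simp
      linear_combination (η ^ 2 * x ^ 2) * h2
    linarith
  linarith

theorem norm_bargmannKernel_le {n : ℕ} (z : Fin n → ℂ) (x : EuclideanSpace ℝ (Fin n)) {η : ℝ}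
    (hη : 0 < η) :
    ‖bargmannKernel z x‖ ≤
      Real.exp ((∑ j, (z j).im ^ 2) / 2 + (1 / (2 * η) - 1 / 2) * ∑ j, (z j).re ^ 2) *
        Real.exp (-(1 / 2 - η) * ‖x‖ ^ 2) := by
  rw [← Real.exp_add, EuclideanSpace.real_norm_sq_eq, Finset.sum_div, Finset.mul_sum,
    Finset.mul_sum, ← Finset.sum_add_distrib, ← Finset.sum_add_distrib, Real.exp_sum,
    bargmannKernel, norm_prod]
  refine Finset.prod_le_prod (fun _ _ => norm_nonneg _) fun j _ => ?_
  refine (norm_bargmannKernelOne_le _ _ hη).trans_eq ?_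
  congr 1; ring

theorem integrable_bargmannKernel {n : ℕ} (z : Fin n → ℂ) : Integrable (bargmannKernel z) := by
  refine Integrable.mono' ((integrable_exp_neg_mul_norm_sq n
    (b := 1 / 2 - 1 / 4) (by norm_num)).const_mul _)
    (continuous_bargmannKernel z).aestronglyMeasurable
    (Eventually.of_forall fun x => norm_bargmannKernel_le z x (by norm_num))

theorem bargmannCoeff_le {n : ℕ} (α : Fin n → ℕ) : bargmannCoeff α ≤ √√Real.pi ^ n := by
  rw [bargmannCoeff]
  refine (Finset.prod_le_prod (g := fun _ => √√Real.pi) (fun _ _ => by positivity)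
    fun j _ => ?_).trans_eq (by simp)
  refine div_le_self (by positivity) ?_
  rw [Real.one_le_sqrt]
  exact_mod_cast Nat.one_le_iff_ne_zero.2 (Nat.factorial_ne_zero _)

theorem bargmannCoeff_sq {n : ℕ} (α : Fin n → ℕ) :
    (bargmannCoeff α : ℂ) * bargmannCoeff α =
      ((√Real.pi : ℝ) : ℂ) ^ n * ∏ j, ((α j).factorial : ℂ)⁻¹ := by
  have : bargmannCoeff α * bargmannCoeff α = √Real.pi ^ n * ∏ j, ((α j).factorial : ℝ)⁻¹ := by
    rw [bargmannCoeff, ← Finset.prod_mul_distrib]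
    have e : ∀ j, √√Real.pi / √((α j).factorial : ℝ) * (√√Real.pi / √((α j).factorial : ℝ)) =
        √Real.pi * ((α j).factorial : ℝ)⁻¹ := fun j => by
      rw [div_mul_div_comm, Real.mul_self_sqrt (Real.sqrt_nonneg _),
        Real.mul_self_sqrt (by positivity), div_eq_mul_inv]
    simp_rw [e, Finset.prod_mul_distrib]
    simp
  rw [← Complex.ofReal_mul, this]
  push_cast
  rfl

theorem hasSum_exp_sum_mul {n : ℕ} (z w : Fin n → ℂ) :
    HasSum (fun α : Fin n → ℕ => (∏ j, ((α j).factorial : ℂ)⁻¹) * (∏ j, w j ^ α j) *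
      ∏ j, z j ^ α j) (Complex.exp (∑ j, w j * z j)) := by
  have h : ∀ j, HasSum (fun k : ℕ => (w j * z j) ^ k / k.factorial) (Complex.exp (w j * z j)) :=
    fun j => by
      rw [Complex.exp_eq_exp_ℂ]; exact NormedSpace.expSeries_div_hasSum_exp _
  rw [Complex.exp_sum]
  refine (hasSum_prod_pi h fun j => (h j).summable.norm).1.congr_fun fun α => ?_
  simp only [← Finset.prod_mul_distrib]
  refine Finset.prod_congr rfl fun j _ => ?_
  rw [mul_pow]; ring

/-- The Bargmann transform of the kernel at `w` is `π^{n/2} e^{z·w}`. Its Taylor coefficients in `z`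
are `π^{n/2} w^α/α!`, and `π^{n/2}/α!` is the square of `bargmannCoeff α`, so uniqueness of
coefficients applies. -/
theorem hermiteCoeff_bargmannKernel {n : ℕ} (w : Fin n → ℂ) :
    hermiteCoeff (bargmannKernel w) = fun α => (bargmannCoeff α : ℂ) * ∏ j, w j ^ α j := by
  refine (gaussIntegrable_of_integrable (integrable_bargmannKernel w)).hermiteCoeff_eq ?_ fun z => ?_
  · refine rapidDecay_bargmannCoeff.mono (A := √√Real.pi ^ n) (B := ∑ j, ‖w j‖) (by positivity)
      fun α => ?_
    rw [norm_mul, norm_mul, Complex.norm_real, Real.norm_of_nonneg (bargmannCoeff_pos α).le]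
    have h1 := (bargmannCoeff_pos α).le
    gcongr
    · exact bargmannCoeff_le α
    · exact norm_prod_pow_le (fun j => Finset.single_le_sum (f := fun j => ‖w j‖)
        (fun _ _ => norm_nonneg _) (Finset.mem_univ j)) α
  · rw [bargmann, integral_bargmannKernel_mul]
    rw [← (hasSum_exp_sum_mul z w).tsum_eq, ← tsum_mul_left]
    congr 1; ext α
    rw [← mul_assoc (bargmannCoeff α : ℂ), bargmannCoeff_sq]
    ring

/-- The Hermite functions are orthonormal. -/
theorem hermiteCoeff_hermiteFunction {n : ℕ} (β : Fin n → ℕ) :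
    hermiteCoeff (fun x => (hermiteFunction β x : ℂ)) = fun α => if α = β then 1 else 0 := by
  refine (gaussIntegrable_of_integrable (integrable_hermiteFunction β)).hermiteCoeff_eq ?_ fun z => ?_
  · intro T hT
    refine summable_of_ne_finset_zero (s := {β}) fun α hα => ?_
    simp [Finset.notMem_singleton.1 hα]
  -- The Bargmann transform of `Φ_β` at `z` is also the `β`-th Hermite coefficient of the kernel at
  -- `z`, already known to be a single monomial.
  · have h := congrFun (hermiteCoeff_bargmannKernel z) β
    rw [hermiteCoeff] at h
    simp_rw [bargmann, mul_comm _ (bargmannKernel z _), h]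
    rw [tsum_eq_single β]
    · simp
    · intro α hα; simp [hα]

theorem continuous_fourierCharacter {n : ℕ} (ξ : EuclideanSpace ℝ (Fin n)) :
    Continuous fun x : EuclideanSpace ℝ (Fin n) =>
      Complex.exp (-Complex.I * ((inner ℝ x ξ : ℝ) : ℂ)) := by
  fun_prop

theorem norm_fourierCharacter {n : ℕ} (x ξ : EuclideanSpace ℝ (Fin n)) :
    ‖Complex.exp (-Complex.I * ((inner ℝ x ξ : ℝ) : ℂ))‖ = 1 := by
  rw [neg_mul, ← mul_neg, ← Complex.ofReal_neg, mul_comm, Complex.norm_exp_ofReal_mul_I]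

/-- This encodes that `Φ_α` is an eigenfunction of the Fourier transform with eigenvalue `(-i)^|α|`.
It is read off from the rotated kernel by comparing Taylor coefficients; the character is bounded
but not integrable, which is why `GaussIntegrable` is the working class. -/
theorem hermiteCoeff_fourierCharacter {n : ℕ} (ξ : EuclideanSpace ℝ (Fin n)) :
    hermiteCoeff (fun x => Complex.exp (-Complex.I * ((inner ℝ x ξ : ℝ) : ℂ))) =
      fun α => ((√(2 * Real.pi) : ℝ) : ℂ) ^ n *
        ((-Complex.I) ^ multiDegree α * hermiteFunction α ξ) := by
  refine (gaussIntegrable_of_bound (continuous_fourierCharacter ξ) (C := 1)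
    fun x => (norm_fourierCharacter x ξ).le).hermiteCoeff_eq ?_ fun z => ?_
  · obtain ⟨B, hB, h⟩ := exists_hermiteFunction_le n
    refine rapidDecay_bargmannCoeff.mono (A := √(2 * Real.pi) ^ n) (B := B) (by linarith) fun α => ?_
    rw [norm_mul, norm_mul, norm_mul, norm_pow, norm_pow, norm_neg, Complex.norm_I, one_pow, one_mul,
      Complex.norm_real (√_), Real.norm_of_nonneg (Real.sqrt_nonneg _)]
    have h1 : ‖(hermiteFunction α ξ : ℂ)‖ ≤ B ^ multiDegree α := by
      refine (h α ξ).trans (mul_le_of_le_one_right (by positivity) ?_)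
      exact Real.exp_le_one_iff.2 (by nlinarith [sq_nonneg ‖ξ‖])
    refine (mul_le_mul_of_nonneg_left (mul_le_mul_of_nonneg_left h1 (by positivity))
      (norm_nonneg _)).trans_eq ?_
    ring
  · rw [bargmann, integral_bargmannKernel_fourier, ← (hasSum_bargmannKernel _ ξ).tsum_eq,
      ← tsum_mul_left]
    congr 1; ext α
    simp only [mul_pow, Finset.prod_mul_distrib, Finset.prod_pow_eq_pow_sum, multiDegree]
    ring

/-! ### Hermite series with rapidly decaying coefficients -/

/-- The entire function with Hermite coefficients `c`, after removal of the Gaussian factor. -/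
def hermitePolySeries {n : ℕ} (c : (Fin n → ℕ) → ℂ) (z : EuclideanSpace ℂ (Fin n)) : ℂ :=
  ∑' α, c α * hermitePolyMulti α z

/-- The function on `ℝⁿ` with Hermite coefficients `c`. -/
def hermiteSeries {n : ℕ} (c : (Fin n → ℕ) → ℂ) (x : EuclideanSpace ℝ (Fin n)) : ℂ :=
  ∑' α, c α * hermiteFunction α x

theorem hermiteSeries_eq {n : ℕ} (c : (Fin n → ℕ) → ℂ) (x : EuclideanSpace ℝ (Fin n)) :
    hermiteSeries c x =
      hermitePolySeries c (realToComplex x) * Complex.exp (-(‖x‖ : ℂ) ^ 2 / 2) := by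
  rw [hermiteSeries, hermitePolySeries, ← tsum_mul_right]
  congr 1; ext α
  rw [hermiteFunction_eq]; ring

theorem RapidDecay.differentiable_hermitePolySeries {n : ℕ} {c : (Fin n → ℕ) → ℂ}
    (hc : RapidDecay c) : Differentiable ℂ (hermitePolySeries c) := by
  refine differentiable_tsum_of_rapidDecay hc differentiable_hermitePolyMulti fun R => ?_
  obtain ⟨B, hB, h⟩ := exists_norm_hermitePolyMulti_le n one_pos
  refine ⟨Real.exp (1 * R ^ 2), B, by linarith, fun α z hz => (h α z).trans ?_⟩
  rw [mul_comm]
  gcongr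

theorem RapidDecay.exists_norm_hermitePolySeries_le {n : ℕ} {c : (Fin n → ℕ) → ℂ}
    (hc : RapidDecay c) {ε : ℝ} (hε : 0 < ε) :
    ∃ C : ℝ, 0 ≤ C ∧ ∀ z, ‖hermitePolySeries c z‖ ≤ C * Real.exp (ε * ‖z‖ ^ 2) := by
  obtain ⟨B, hB, h⟩ := exists_norm_hermitePolyMulti_le n hε
  have hs := hc B (by linarith)
  refine ⟨∑' α, ‖c α‖ * B ^ multiDegree α, tsum_nonneg fun α => by positivity, fun z => ?_⟩
  rw [← tsum_mul_right]
  refine tsum_of_norm_bounded (hs.mul_right _).hasSum fun α => ?_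
  rw [norm_mul, mul_assoc]
  gcongr
  exact h α z

theorem RapidDecay.isEntireOrderTwoMinimalType {n : ℕ} {c : (Fin n → ℕ) → ℂ}
    (hc : RapidDecay c) : IsEntireOrderTwoMinimalType (hermitePolySeries c) :=
  ⟨hc.differentiable_hermitePolySeries, fun _ hε =>
    let ⟨C, _, h⟩ := hc.exists_norm_hermitePolySeries_le hε
    ⟨C, h⟩⟩

theorem norm_cexp_neg_norm_sq {n : ℕ} (x : EuclideanSpace ℝ (Fin n)) :
    ‖Complex.exp (-(‖x‖ : ℂ) ^ 2 / 2)‖ = Real.exp (-(1 / 2) * ‖x‖ ^ 2) := by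
  rw [show (-(‖x‖ : ℂ) ^ 2 / 2) = ((-(1 / 2) * ‖x‖ ^ 2 : ℝ) : ℂ) by push_cast; ring,
    ← Complex.ofReal_exp, Complex.norm_real, Real.norm_of_nonneg (Real.exp_pos _).le]

theorem norm_hermiteSeries {n : ℕ} (c : (Fin n → ℕ) → ℂ) (x : EuclideanSpace ℝ (Fin n)) :
    ‖hermiteSeries c x‖ =
      ‖hermitePolySeries c (realToComplex x)‖ * Real.exp (-(1 / 2) * ‖x‖ ^ 2) := by
  rw [hermiteSeries_eq, norm_mul, norm_cexp_neg_norm_sq]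

theorem RapidDecay.continuous_hermiteSeries {n : ℕ} {c : (Fin n → ℕ) → ℂ} (hc : RapidDecay c) :
    Continuous (hermiteSeries c) := by
  simp_rw [funext (hermiteSeries_eq c)]
  exact (hc.differentiable_hermitePolySeries.continuous.comp continuous_realToComplex).mul
    (by fun_prop)

theorem RapidDecay.exists_norm_hermiteSeries_le {n : ℕ} {c : (Fin n → ℕ) → ℂ} (hc : RapidDecay c) :
    ∃ C : ℝ, 0 ≤ C ∧ ∀ x, ‖hermiteSeries c x‖ ≤ C * Real.exp (-(1 / 4) * ‖x‖ ^ 2) := by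
  obtain ⟨C, hC, h⟩ := hc.exists_norm_hermitePolySeries_le (show (0 : ℝ) < 1 / 4 by norm_num)
  refine ⟨C, hC, fun x => ?_⟩
  rw [norm_hermiteSeries]
  refine (mul_le_mul_of_nonneg_right (h _) (Real.exp_pos _).le).trans_eq ?_
  rw [mul_assoc, ← Real.exp_add, norm_realToComplex]
  ring_nf

theorem integrable_of_gauss_bound {n : ℕ} {f : EuclideanSpace ℝ (Fin n) → ℂ} (hf : Continuous f)
    {b C : ℝ} (hb : 0 < b) (h : ∀ x, ‖f x‖ ≤ C * Real.exp (-b * ‖x‖ ^ 2)) : Integrable f :=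
  ((integrable_exp_neg_mul_norm_sq n hb).const_mul C).mono' hf.aestronglyMeasurable
    (Eventually.of_forall h)

theorem RapidDecay.integrable_hermiteSeries {n : ℕ} {c : (Fin n → ℕ) → ℂ} (hc : RapidDecay c) :
    Integrable (hermiteSeries c) :=
  let ⟨_, _, h⟩ := hc.exists_norm_hermiteSeries_le
  integrable_of_gauss_bound hc.continuous_hermiteSeries (by norm_num) h

theorem RapidDecay.memLp_hermiteSeries {n : ℕ} {c : (Fin n → ℕ) → ℂ} (hc : RapidDecay c) :
    MemLp (hermiteSeries c) 2 := by
  obtain ⟨C, _, h⟩ := hc.exists_norm_hermiteSeries_le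
  refine MemLp.of_le_mul (memLp_exp_neg_mul_norm_sq n (b := 1 / 4) (by norm_num))
    hc.continuous_hermiteSeries.aestronglyMeasurable (c := C) (Eventually.of_forall fun x => ?_)
  rw [Real.norm_of_nonneg (Real.exp_pos _).le]
  exact h x

/-- Rapid decay beats the geometric growth of the integrals of `‖g Φ_α‖`, so sum and integral may be
exchanged. With `g = Φ_β` this recovers the coefficients; with `g` a Fourier character it gives the
Fourier transform. -/
theorem RapidDecay.integral_mul_hermiteSeries {n : ℕ} {c : (Fin n → ℕ) → ℂ} (hc : RapidDecay c)
    {g : EuclideanSpace ℝ (Fin n) → ℂ} (hg : GaussIntegrable g) :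
    ∫ x, g x * hermiteSeries c x = ∑' α, c α * hermiteCoeff g α := by
  obtain ⟨D, B, hD, hB, h⟩ := hg.exists_integral_le
  have h1 := hasSum_integral_of_summable_integral_norm (μ := volume)
    (F := fun α x => c α * (g x * (hermiteFunction α x : ℂ))) (fun α => (h α).1.const_mul _) ?_
  · simp_rw [integral_const_mul] at h1
    rw [show (∑' α, c α * hermiteCoeff g α) = _ from h1.tsum_eq]
    congr 1; ext x
    rw [hermiteSeries, ← tsum_mul_left]
    congr 1; ext α
    ring
  · refine Summable.of_nonneg_of_le (fun α => integral_nonneg fun _ => norm_nonneg _) (fun α => ?_)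
      ((hc B (by linarith)).mul_left D)
    simp_rw [norm_mul (c α)]
    rw [integral_const_mul]
    refine (mul_le_mul_of_nonneg_left (h α).2 (norm_nonneg _)).trans_eq ?_
    ring

theorem RapidDecay.hermiteCoeff_hermiteSeries {n : ℕ} {c : (Fin n → ℕ) → ℂ} (hc : RapidDecay c) :
    hermiteCoeff (hermiteSeries c) = c := by
  ext β
  have h := hc.integral_mul_hermiteSeries
    (gaussIntegrable_of_integrable (integrable_hermiteFunction β))
  rw [hermiteCoeff_hermiteFunction, tsum_eq_single β (fun α hα => by simp [hα])] at h
  simp_rw [hermiteCoeff, mul_comm (hermiteSeries c _), h]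
  simp

theorem RapidDecay.rotate {n : ℕ} {c : (Fin n → ℕ) → ℂ} (hc : RapidDecay c) :
    RapidDecay fun α => (-Complex.I) ^ multiDegree α * c α :=
  hc.mono (A := 1) (B := 1) zero_le_one fun α => by simp

theorem unitaryFourier_const_mul (n : ℕ) :
    (((2 * Real.pi) ^ (-(n : ℝ) / 2) : ℝ) : ℂ) * ((√(2 * Real.pi) : ℝ) : ℂ) ^ n = 1 := by
  have : (2 * Real.pi) ^ (-(n : ℝ) / 2) * √(2 * Real.pi) ^ n = 1 := by
    rw [Real.sqrt_eq_rpow, ← Real.rpow_natCast, ← Real.rpow_mul (by positivity),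
      ← Real.rpow_add (by positivity)]
    ring_nf
    simp
  rw [← Complex.ofReal_pow, ← Complex.ofReal_mul, this, Complex.ofReal_one]

theorem RapidDecay.unitaryFourier_hermiteSeries {n : ℕ} {c : (Fin n → ℕ) → ℂ} (hc : RapidDecay c) :
    unitaryFourier (hermiteSeries c) =
      hermiteSeries fun α => (-Complex.I) ^ multiDegree α * c α := by
  ext ξ
  rw [unitaryFourier, hc.integral_mul_hermiteSeries (gaussIntegrable_of_bound
    (continuous_fourierCharacter ξ) (C := 1) fun x => (norm_fourierCharacter x ξ).le),
    hermiteCoeff_fourierCharacter, hermiteSeries, ← tsum_mul_left]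
  congr 1; ext α
  linear_combination (c α * ((-Complex.I) ^ multiDegree α * hermiteFunction α ξ)) *
    unitaryFourier_const_mul n

theorem RapidDecay.tendsto_eLpNorm_sub {n : ℕ} {c : (Fin n → ℕ) → ℂ} (hc : RapidDecay c) :
    Tendsto (fun s : Finset (Fin n → ℕ) => eLpNorm (fun x => hermiteSeries c x -
      ∑ α ∈ s, c α * (hermiteFunction α x : ℂ)) 2 volume) atTop (𝓝 0) := by
  obtain ⟨B, hB, h⟩ := exists_hermiteFunction_le n
  have hs := hc B (by linarith)
  have hle : ∀ s : Finset (Fin n → ℕ), eLpNorm (fun x => hermiteSeries c x -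
      ∑ α ∈ s, c α * (hermiteFunction α x : ℂ)) 2 volume ≤
      ENNReal.ofReal (∑' α : {α // α ∉ s}, ‖c α‖ * B ^ multiDegree (α : Fin n → ℕ)) *
      eLpNorm (fun x : EuclideanSpace ℝ (Fin n) => Real.exp (-(1 / 4) * ‖x‖ ^ 2)) 2 volume := by
    intro s
    refine eLpNorm_le_mul_eLpNorm_of_ae_le_mul (Eventually.of_forall fun x => ?_) 2
    have hb : ∀ α, ‖c α * (hermiteFunction α x : ℂ)‖ ≤
        ‖c α‖ * B ^ multiDegree α * Real.exp (-(1 / 4) * ‖x‖ ^ 2) := fun α => by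
      rw [norm_mul, mul_assoc]
      gcongr
      exact h α x
    have hsum : Summable fun α => c α * (hermiteFunction α x : ℂ) :=
      (hs.mul_right _).of_norm_bounded hb
    rw [hermiteSeries, ← hsum.sum_add_tsum_subtype_compl s, add_sub_cancel_left,
      Real.norm_of_nonneg (Real.exp_pos _).le, ← tsum_mul_right]
    refine tsum_of_norm_bounded (Summable.hasSum ?_) fun α => hb α
    exact ((hs.mul_right _).subtype _)
  refine tendsto_of_tendsto_of_tendsto_of_le_of_le tendsto_const_nhds ?_ (fun _ => zero_le) hle
  have h0 := (tendsto_tsum_compl_atTop_zero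
    fun α : Fin n → ℕ => ‖c α‖ * B ^ multiDegree α)
  have h1 := ENNReal.Tendsto.mul_const (ENNReal.tendsto_ofReal h0)
    (b := eLpNorm (fun x : EuclideanSpace ℝ (Fin n) => Real.exp (-(1 / 4) * ‖x‖ ^ 2)) 2 volume)
    (Or.inr (memLp_exp_neg_mul_norm_sq n (b := 1 / 4) (by norm_num)).2.ne)
  simpa using h1

/-- The semigroup is inverted on coefficients: multiplication by `e^{(2|α|+n)t}` is geometric in
`|α|`, so it preserves rapid decay. -/
theorem RapidDecay.isHermiteSemigroup {n : ℕ} {c : (Fin n → ℕ) → ℂ} (hc : RapidDecay c) (t : ℝ) :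
    ∃ φ : EuclideanSpace ℝ (Fin n) → ℂ,
      MemLp φ 2 volume ∧ IsHermiteSemigroup t φ (hermiteSeries c) := by
  set d : (Fin n → ℕ) → ℂ := fun α => (Real.exp (((2 * ∑ j, (α j : ℝ)) + n) * t) : ℂ) * c α with hdd
  have hd : RapidDecay d := by
    refine hc.mono (A := Real.exp (n * t)) (B := Real.exp (2 * t)) (Real.exp_pos _).le fun α => ?_
    rw [hdd]
    simp only
    rw [norm_mul, Complex.norm_real, Real.norm_of_nonneg (Real.exp_pos _).le, ← Real.exp_nat_mul,
      mul_left_comm, ← Real.exp_add, mul_comm, multiDegree]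
    refine le_of_eq ?_
    push_cast
    ring_nf
  refine ⟨hermiteSeries d, hd.memLp_hermiteSeries, ?_⟩
  rw [IsHermiteSemigroup, hd.hermiteCoeff_hermiteSeries]
  convert! hc.tendsto_eLpNorm_sub using 7 with s x α
  rw [hdd]
  simp only
  rw [← mul_assoc, ← Complex.ofReal_mul, ← Real.exp_add, neg_mul, neg_add_cancel, Real.exp_zero,
    Complex.ofReal_one, one_mul]

/-! ### Entire extensions -/

/-- Entire functions on `ℂⁿ` are determined by their restriction to `ℝⁿ`. -/
theorem eq_of_realRestriction_eq {n : ℕ} {F G : EuclideanSpace ℂ (Fin n) → ℂ}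
    (hF : Differentiable ℂ F) (hG : Differentiable ℂ G)
    (h : realRestriction F = realRestriction G) : F = G := by
  ext z
  let x : EuclideanSpace ℝ (Fin n) := WithLp.toLp 2 fun j => (z j).re
  let y : EuclideanSpace ℝ (Fin n) := WithLp.toLp 2 fun j => (z j).im
  -- The complex line `w ↦ x + wy` meets `ℝⁿ` for real `w` and passes through `z` at `w = i`, which
  -- reduces the claim to the identity theorem in one variable.
  let L : ℂ → EuclideanSpace ℂ (Fin n) := fun w => realToComplex x + w • realToComplex y
  have hL : Differentiable ℂ L := by fun_prop
  have hreal : ∀ t : ℝ, L t = realToComplex (x + t • y) := fun t => by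
    ext j; simp [L]
  have hz : L Complex.I = z := by
    ext j
    simp only [L, PiLp.add_apply, PiLp.smul_apply, realToComplex_apply, smul_eq_mul, x, y]
    rw [mul_comm]; exact Complex.re_add_im (z j)
  have ha : AnalyticOnNhd ℂ (F ∘ L) Set.univ := fun w _ => (hF.comp hL).analyticAt w
  have hb : AnalyticOnNhd ℂ (G ∘ L) Set.univ := fun w _ => (hG.comp hL).analyticAt w
  have ht : Tendsto (fun t : ℝ => (t : ℂ)) (𝓝[≠] 0) (𝓝[≠] 0) := by
    refine tendsto_nhdsWithin_of_tendsto_nhds_of_eventually_within _ ?_ ?_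
    · exact (Complex.continuous_ofReal.tendsto' 0 0 (by simp)).mono_left nhdsWithin_le_nhds
    · filter_upwards [self_mem_nhdsWithin] with t ht
      simpa using ht
  have hf : ∃ᶠ w in 𝓝[≠] (0 : ℂ), (F ∘ L) w = (G ∘ L) w :=
    ht.frequently (Frequently.of_forall fun t => by
      simp only [Function.comp_apply, hreal]
      exact congrFun h (x + t • y))
  have := congrFun (ha.eq_of_frequently_eq hb hf) Complex.I
  simpa only [Function.comp_apply, hz] using this

/-- The entire extension of `hermiteSeries c`. -/
def hermiteEntire {n : ℕ} (c : (Fin n → ℕ) → ℂ) (z : EuclideanSpace ℂ (Fin n)) : ℂ :=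
  hermitePolySeries c z * Complex.exp (-(∑ j, z j ^ 2) / 2)

theorem RapidDecay.differentiable_hermiteEntire {n : ℕ} {c : (Fin n → ℕ) → ℂ}
    (hc : RapidDecay c) : Differentiable ℂ (hermiteEntire c) :=
  hc.differentiable_hermitePolySeries.mul (by fun_prop)

theorem realRestriction_hermiteEntire {n : ℕ} (c : (Fin n → ℕ) → ℂ) :
    realRestriction (hermiteEntire c) = hermiteSeries c := by
  ext x
  rw [hermiteSeries_eq, realRestriction, hermiteEntire]
  simp only [realToComplex_apply, sum_ofReal_sq]

theorem mulExpHalfSq_hermiteEntire {n : ℕ} (c : (Fin n → ℕ) → ℂ) :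
    mulExpHalfSq (hermiteEntire c) = hermitePolySeries c := by
  ext z
  rw [mulExpHalfSq, hermiteEntire, mul_assoc, ← Complex.exp_add]
  ring_nf
  simp

theorem RapidDecay.hermiteEntire_mem {n : ℕ} {c : (Fin n → ℕ) → ℂ} (hc : RapidDecay c) :
    hermiteEntire c ∈ HermiteBergmanInf n := by
  simp only [HermiteBergmanInf, Set.mem_iInter]
  intro t _
  refine ⟨hc.differentiable_hermiteEntire, ?_⟩
  rw [realRestriction_hermiteEntire]
  exact hc.isHermiteSemigroup t

/-! ### Elements of `H_∞` have rapidly decaying coefficients -/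

theorem enorm_integral_mul_le {n : ℕ} {f g : EuclideanSpace ℝ (Fin n) → ℂ} (hf : MemLp f 2)
    (hg : MemLp g 2) : ‖∫ x, f x * g x‖ₑ ≤ eLpNorm f 2 volume * eLpNorm g 2 volume := by
  refine (enorm_integral_le_lintegral_enorm _).trans ?_
  rw [← eLpNorm_one_eq_lintegral_enorm]
  change eLpNorm (f • g) 1 volume ≤ _
  exact eLpNorm_smul_le_mul_eLpNorm (𝕜 := ℂ) (f := g) (φ := f) (p := 2) (q := 2) (r := 1) hg.1 hf.1

theorem exists_norm_hermiteCoeff_le {n : ℕ} : ∃ B : ℝ, 1 ≤ B ∧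
    ∀ φ : EuclideanSpace ℝ (Fin n) → ℂ, MemLp φ 2 → ∃ K : ℝ, 0 ≤ K ∧
      ∀ α, ‖hermiteCoeff φ α‖ ≤ K * B ^ multiDegree α := by
  obtain ⟨B, hB, h⟩ := exists_hermiteFunction_le n
  refine ⟨B, hB, fun φ hφ => ?_⟩
  set g := fun x : EuclideanSpace ℝ (Fin n) => Real.exp (-(1 / 4) * ‖x‖ ^ 2) with hg
  have hg2 : MemLp g 2 := memLp_exp_neg_mul_norm_sq n (b := 1 / 4) (by norm_num)
  refine ⟨(eLpNorm φ 2 volume * eLpNorm g 2 volume).toReal, ENNReal.toReal_nonneg, fun α => ?_⟩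
  have h1 := enorm_integral_mul_le hφ (memLp_hermiteFunction α)
  have h2 : eLpNorm (fun x => (hermiteFunction α x : ℂ)) 2 volume ≤
      ENNReal.ofReal (B ^ multiDegree α) * eLpNorm g 2 volume := by
    refine eLpNorm_le_mul_eLpNorm_of_ae_le_mul (Eventually.of_forall fun x => ?_) 2
    rw [Real.norm_of_nonneg (Real.exp_pos _).le]
    exact h α x
  have h3 : ‖hermiteCoeff φ α‖ₑ ≤
      (eLpNorm φ 2 volume * eLpNorm g 2 volume) * ENNReal.ofReal (B ^ multiDegree α) := by
    refine h1.trans ((mul_le_mul_right h2 _).trans_eq ?_)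
    ring
  have h4 := ENNReal.toReal_mono (ENNReal.mul_ne_top (ENNReal.mul_ne_top hφ.2.ne hg2.2.ne)
    ENNReal.ofReal_ne_top) h3
  rwa [toReal_enorm, ENNReal.toReal_mul, ENNReal.toReal_ofReal (by positivity)] at h4

theorem memLp_sum_hermiteFunction {n : ℕ} (d : (Fin n → ℕ) → ℂ) (s : Finset (Fin n → ℕ)) :
    MemLp (fun x => ∑ α ∈ s, d α * (hermiteFunction α x : ℂ)) 2 :=
  memLp_finsetSum s fun α _ => (memLp_hermiteFunction α).const_mul (d α)

theorem integrable_mul_of_memLp_two {n : ℕ} {f g : EuclideanSpace ℝ (Fin n) → ℂ} (hf : MemLp f 2)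
    (hg : MemLp g 2) : Integrable fun x => f x * g x :=
  hf.integrable_mul hg

/-- The coefficients of an `L²`-convergent Hermite series are the Hermite coefficients of its
sum. -/
theorem hermiteCoeff_eq_of_tendsto {n : ℕ} {f : EuclideanSpace ℝ (Fin n) → ℂ}
    (hf : AEStronglyMeasurable f) {d : (Fin n → ℕ) → ℂ}
    (h : Tendsto (fun s : Finset (Fin n → ℕ) => eLpNorm (fun x => f x -
      ∑ α ∈ s, d α * (hermiteFunction α x : ℂ)) 2 volume) atTop (𝓝 0)) : hermiteCoeff f = d := by
  ext β
  have hsub : ∀ s, AEStronglyMeasurable (fun x => f x - ∑ α ∈ s, d α * (hermiteFunction α x : ℂ)) :=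
    fun s => hf.sub (memLp_sum_hermiteFunction d s).1
  have hev : ∀ᶠ s : Finset (Fin n → ℕ) in atTop, ‖hermiteCoeff f β - d β‖ₑ ≤
      eLpNorm (fun x => f x - ∑ α ∈ s, d α * (hermiteFunction α x : ℂ)) 2 volume *
        eLpNorm (fun x => (hermiteFunction β x : ℂ)) 2 volume := by
    -- Membership of `f` in `L²` is not assumed: it follows from one partial sum at finite distance.
    -- Once `β ∈ s`, orthonormality makes the pairing of the remainder with `Φ_β` equal to the
    -- difference of coefficients.
    filter_upwards [h.eventually_lt_const ENNReal.zero_lt_top, eventually_ge_atTop {β}]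
      with s hs hβ
    have hm : MemLp (fun x => f x - ∑ α ∈ s, d α * (hermiteFunction α x : ℂ)) 2 := ⟨hsub s, hs⟩
    have hf2 : MemLp f 2 := by
      have := hm.add (memLp_sum_hermiteFunction d s)
      refine this.ae_eq (Eventually.of_forall fun x => ?_)
      simp
    refine le_trans (le_of_eq ?_) (enorm_integral_mul_le hm (memLp_hermiteFunction β))
    congr 1
    simp_rw [sub_mul]
    rw [integral_sub (integrable_mul_of_memLp_two hf2 (memLp_hermiteFunction β))
      (integrable_mul_of_memLp_two (memLp_sum_hermiteFunction d s) (memLp_hermiteFunction β)),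
      hermiteCoeff]
    congr 1
    simp_rw [Finset.sum_mul, mul_assoc]
    rw [integral_finsetSum _ fun α _ => (integrable_mul_of_memLp_two (memLp_hermiteFunction α)
      (memLp_hermiteFunction β)).const_mul _]
    simp_rw [integral_const_mul]
    have ho : ∀ α, ∫ x, (hermiteFunction α x : ℂ) * (hermiteFunction β x : ℂ) =
        if β = α then 1 else 0 := fun α => congrFun (hermiteCoeff_hermiteFunction α) β
    simp_rw [ho]
    rw [Finset.sum_eq_single_of_mem β (Finset.singleton_subset_iff.1 hβ)
      (fun α _ hα => by simp [hα.symm])]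
    simp
  have hlim := ENNReal.Tendsto.mul_const h
    (b := eLpNorm (fun x => (hermiteFunction β x : ℂ)) 2 volume)
    (Or.inr (memLp_hermiteFunction β).2.ne)
  rw [zero_mul] at hlim
  have := le_antisymm (ge_of_tendsto hlim hev) zero_le
  rwa [enorm_eq_zero, sub_eq_zero] at this

/-- For each `t` the coefficients are `e^{-(2|α|+n)t}` times those of an `L²` function, which grow
at most geometrically with a ratio independent of `t`; large `t` gives any prescribed decay. The
restriction and the Hermite series are continuous `L²` limits of the same partial sums, so they
agree everywhere. -/
theorem realRestriction_eq_hermiteSeries {n : ℕ} {F : EuclideanSpace ℂ (Fin n) → ℂ}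
    (hF : F ∈ HermiteBergmanInf n) :
    RapidDecay (hermiteCoeff (realRestriction F)) ∧
      realRestriction F = hermiteSeries (hermiteCoeff (realRestriction F)) := by
  simp only [HermiteBergmanInf, Set.mem_iInter] at hF
  set f := realRestriction F with hfF
  have hcont : Continuous f := (hF 1 (Set.mem_Ioi.2 one_pos)).1.continuous.comp continuous_realToComplex
  have hco : ∀ t : ℝ, 0 < t → ∃ φ : EuclideanSpace ℝ (Fin n) → ℂ, MemLp φ 2 ∧
      hermiteCoeff f = (fun α => (Real.exp (-((2 * ∑ j, (α j : ℝ)) + n) * t) : ℂ) *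
        hermiteCoeff φ α) ∧
      Tendsto (fun s : Finset (Fin n → ℕ) => eLpNorm (fun x => f x -
        ∑ α ∈ s, hermiteCoeff f α * (hermiteFunction α x : ℂ)) 2 volume) atTop (𝓝 0) := by
    intro t ht
    obtain ⟨-, φ, hφ, hs⟩ := hF t ht
    have e := hermiteCoeff_eq_of_tendsto hcont.aestronglyMeasurable hs
    refine ⟨φ, hφ, e, ?_⟩
    rw [e]
    exact hs
  obtain ⟨B, hB, hK⟩ := exists_norm_hermiteCoeff_le (n := n)
  have hdecay : RapidDecay (hermiteCoeff f) := by
    refine rapidDecay_of_bound fun T hT => ?_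
    have hBT : 0 < B * T := by positivity
    -- With this `t`, `e^{-2t} = 1/(BT+1) ≤ 1/(BT)`, which cancels both `B^|α|` and `T^|α|`. The
    -- added `1` keeps `t` positive.
    obtain ⟨φ, hφ, e, -⟩ := hco (Real.log (B * T + 1) / 2)
      (div_pos (Real.log_pos (by linarith)) two_pos)
    obtain ⟨K, hK0, hK⟩ := hK φ hφ
    refine ⟨K, fun α => ?_⟩
    have hle : Real.exp (-((2 * ∑ j, (α j : ℝ)) + n) * (Real.log (B * T + 1) / 2)) ≤
        ((B * T)⁻¹) ^ multiDegree α := by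
      have h1 : ((B * T)⁻¹) ^ multiDegree α =
          Real.exp (-(Real.log (B * T)) * (∑ j, (α j : ℝ))) := by
        rw [← Real.exp_log (inv_pos.2 hBT), ← Real.exp_nat_mul, Real.log_inv, multiDegree]
        push_cast; ring_nf
      rw [h1, Real.exp_le_exp]
      have h2 : Real.log (B * T) ≤ Real.log (B * T + 1) := Real.log_le_log hBT (by linarith)
      have h3 : 0 ≤ Real.log (B * T + 1) := Real.log_nonneg (by linarith)
      have h4 : 0 ≤ ∑ j, (α j : ℝ) := Finset.sum_nonneg fun _ _ => by positivity
      have h5 : (0 : ℝ) ≤ n := by positivity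
      nlinarith [mul_nonneg h5 h3, mul_le_mul_of_nonneg_right h2 h4]
    rw [e]
    simp only
    rw [norm_mul, Complex.norm_real, Real.norm_of_nonneg (Real.exp_pos _).le]
    calc _ ≤ ((B * T)⁻¹) ^ multiDegree α * (K * B ^ multiDegree α) * T ^ multiDegree α := by
          gcongr; exact hK α
      _ = K * ((B * T)⁻¹ * (B * T)) ^ multiDegree α := by rw [mul_pow, mul_pow]; ring
      _ = K := by rw [inv_mul_cancel₀ hBT.ne']; simp
  refine ⟨hdecay, ?_⟩
  obtain ⟨-, -, -, h1⟩ := hco 1 one_pos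
  have h2 := hdecay.tendsto_eLpNorm_sub
  have hser := hdecay.continuous_hermiteSeries
  have h3 := h1.add h2
  rw [add_zero] at h3
  have h4 : ∀ s : Finset (Fin n → ℕ), eLpNorm (fun x => f x - hermiteSeries (hermiteCoeff f) x)
      2 volume ≤ eLpNorm (fun x => f x -
        ∑ α ∈ s, hermiteCoeff f α * (hermiteFunction α x : ℂ)) 2 volume +
      eLpNorm (fun x => hermiteSeries (hermiteCoeff f) x -
        ∑ α ∈ s, hermiteCoeff f α * (hermiteFunction α x : ℂ)) 2 volume := by
    intro s
    have hS := (memLp_sum_hermiteFunction (hermiteCoeff f) s).1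
    have e : (fun x => f x - hermiteSeries (hermiteCoeff f) x) =
        (fun x => f x - ∑ α ∈ s, hermiteCoeff f α * (hermiteFunction α x : ℂ)) -
        (fun x => hermiteSeries (hermiteCoeff f) x -
          ∑ α ∈ s, hermiteCoeff f α * (hermiteFunction α x : ℂ)) := by
      ext x; simp
    rw [e]
    exact eLpNorm_sub_le (hcont.aestronglyMeasurable.sub hS) (hser.aestronglyMeasurable.sub hS)
      (by norm_num)
  have h5 := le_antisymm (ge_of_tendsto' h3 h4) zero_le
  have h6 := (eLpNorm_eq_zero_iff (hcont.sub hser).aestronglyMeasurable two_ne_zero).1 h5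
  refine (Continuous.ae_eq_iff_eq volume hcont hser).1 ?_
  filter_upwards [h6] with x hx
  exact sub_eq_zero.1 hx

/-! ### The Pfannschmidt condition and Gaussian bounds -/

/-- Adding `1` makes the function positive and its logarithm nonnegative, so the quotient actually
tends to `0`. Positive dimension makes the filter at infinity nontrivial; otherwise the limsup would
be `⊥`. -/
theorem logLimsupZero_one_add {n : ℕ} (hn : 1 ≤ n) {R : EuclideanSpace ℝ (Fin n) → ℂ}
    (h : ∀ ε : ℝ, 0 < ε → ∃ C : ℝ, 0 ≤ C ∧ ∀ x, ‖R x‖ ≤ C * Real.exp (ε * ‖x‖ ^ 2)) :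
    LogLimsupZero fun x => 1 + ‖R x‖ := by
  have : Nonempty (Fin n) := ⟨⟨0, hn⟩⟩
  have hne : (Bornology.cobounded (EuclideanSpace ℝ (Fin n))).NeBot := inferInstance
  have hsq : Tendsto (fun x : EuclideanSpace ℝ (Fin n) => ‖x‖ ^ 2)
      (Bornology.cobounded (EuclideanSpace ℝ (Fin n))) atTop :=
    (tendsto_pow_atTop two_ne_zero).comp tendsto_norm_cobounded_atTop
  have ht : Tendsto (fun x => Real.log (1 + ‖R x‖) / ‖x‖ ^ 2)
      (Bornology.cobounded (EuclideanSpace ℝ (Fin n))) (𝓝 0) := by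
    refine tendsto_order.2 ⟨fun a ha => Eventually.of_forall fun x => ha.trans_le ?_, fun ε hε => ?_⟩
    · exact div_nonneg (Real.log_nonneg (by linarith [norm_nonneg (R x)])) (by positivity)
    · obtain ⟨C, hC, hR⟩ := h (ε / 2) (by positivity)
      have hlim : Tendsto (fun x : EuclideanSpace ℝ (Fin n) => Real.log (1 + C) / ‖x‖ ^ 2)
          (Bornology.cobounded (EuclideanSpace ℝ (Fin n))) (𝓝 0) := hsq.const_div_atTop _
      filter_upwards [hlim.eventually_lt_const (show (0 : ℝ) < ε / 2 by positivity),
        hsq.eventually_gt_atTop 0] with x hx hpos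
      have h1 : Real.log (1 + ‖R x‖) ≤ Real.log (1 + C) + ε / 2 * ‖x‖ ^ 2 := by
        rw [← Real.log_exp (ε / 2 * ‖x‖ ^ 2), ← Real.log_mul (by positivity) (Real.exp_pos _).ne']
        refine Real.log_le_log (by positivity) ?_
        have := Real.one_le_exp (show 0 ≤ ε / 2 * ‖x‖ ^ 2 by positivity)
        linarith [hR x]
      calc _ ≤ (Real.log (1 + C) + ε / 2 * ‖x‖ ^ 2) / ‖x‖ ^ 2 := by gcongr
        _ = Real.log (1 + C) / ‖x‖ ^ 2 + ε / 2 := by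
          rw [add_div, mul_div_cancel_right₀ _ hpos.ne']
        _ < ε := by linarith
  exact ((continuous_coe_real_ereal.tendsto 0).comp ht).limsup_eq

theorem RapidDecay.pfannschmidtCondition {n : ℕ} (hn : 1 ≤ n) {c : (Fin n → ℕ) → ℂ}
    (hc : RapidDecay c) : PfannschmidtCondition 1 1 (hermiteSeries c) := by
  have hb : ∀ {d : (Fin n → ℕ) → ℂ}, RapidDecay d → ∀ ε : ℝ, 0 < ε → ∃ C : ℝ, 0 ≤ C ∧
      ∀ x : EuclideanSpace ℝ (Fin n),
        ‖hermitePolySeries d (realToComplex x)‖ ≤ C * Real.exp (ε * ‖x‖ ^ 2) := by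
    intro d hd ε hε
    obtain ⟨C, hC, h⟩ := hd.exists_norm_hermitePolySeries_le hε
    exact ⟨C, hC, fun x => by simpa only [norm_realToComplex] using h (realToComplex x)⟩
  have hle : ∀ (d : (Fin n → ℕ) → ℂ) (x : EuclideanSpace ℝ (Fin n)), ‖hermiteSeries d x‖ ≤
      (1 + ‖hermitePolySeries d (realToComplex x)‖) * Real.exp (-(1 / 2) * 1 * ‖x‖ ^ 2) := by
    intro d x
    rw [norm_hermiteSeries, mul_one]
    gcongr
    linarith
  refine ⟨hc.continuous_hermiteSeries.measurable, _, _, fun x => ?_, fun ξ => ?_, hle c, ?_,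
    logLimsupZero_one_add hn (hb hc), logLimsupZero_one_add hn (hb hc.rotate)⟩
  · positivity
  · positivity
  · rw [hc.unitaryFourier_hermiteSeries]
    exact hle _

theorem LogLimsupZero.exists_le_exp {n : ℕ} {P : EuclideanSpace ℝ (Fin n) → ℝ}
    (hP : LogLimsupZero P) (hpos : ∀ x, 0 < P x) {ε : ℝ} (hε : 0 < ε) :
    ∃ R : ℝ, ∀ x, R ≤ ‖x‖ → P x ≤ Real.exp (ε * ‖x‖ ^ 2) := by
  have h1 : limsup (fun x => ((Real.log (P x) / ‖x‖ ^ 2 : ℝ) : EReal))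
      (Bornology.cobounded (EuclideanSpace ℝ (Fin n))) < (ε : EReal) := by
    rw [hP]; exact_mod_cast hε
  obtain ⟨R, -, hR⟩ := hasBasis_cobounded_norm.eventually_iff.1 (eventually_lt_of_limsup_lt h1)
  refine ⟨max R 1, fun x hx => ?_⟩
  have hx1 : 0 < ‖x‖ := by linarith [le_max_right R 1]
  have h2 := hR (show x ∈ {x | R ≤ ‖x‖} from (le_max_left R 1).trans hx)
  have h3 : Real.log (P x) / ‖x‖ ^ 2 < ε := by exact_mod_cast h2
  rw [div_lt_iff₀ (by positivity)] at h3
  exact (Real.log_le_iff_le_exp (hpos x)).1 h3.le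

/-- The limsup controls `P` only near infinity, and `P` may be unbounded on balls. Local boundedness
of `f` is therefore a separate hypothesis: it comes from continuity for the function, and from the
`L¹` norm for its Fourier transform. -/
theorem LogLimsupZero.exists_gauss_bound {n : ℕ} {P : EuclideanSpace ℝ (Fin n) → ℝ}
    (hP : LogLimsupZero P) (hpos : ∀ x, 0 < P x) {f : EuclideanSpace ℝ (Fin n) → ℂ}
    (hf : ∀ x, ‖f x‖ ≤ P x * Real.exp (-(1 / 2) * 1 * ‖x‖ ^ 2))
    (hb : ∀ R : ℝ, ∃ M, ∀ x, ‖x‖ ≤ R → ‖f x‖ ≤ M) {ε : ℝ} (hε : 0 < ε) :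
    ∃ C : ℝ, 0 ≤ C ∧ ∀ x, ‖f x‖ ≤ C * Real.exp (-(1 / 2 - ε) * ‖x‖ ^ 2) := by
  obtain ⟨R, hR⟩ := hP.exists_le_exp hpos hε
  obtain ⟨M, hM⟩ := hb R
  refine ⟨1 + |M| * Real.exp (1 / 2 * R ^ 2), by positivity, fun x => ?_⟩
  rw [add_mul, one_mul]
  rcases le_total R ‖x‖ with h | h
  · have h1 : ‖f x‖ ≤ Real.exp (-(1 / 2 - ε) * ‖x‖ ^ 2) := by
      refine (hf x).trans ((mul_le_mul_of_nonneg_right (hR x h) (Real.exp_pos _).le).trans_eq ?_)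
      rw [← Real.exp_add]; ring_nf
    have : 0 ≤ |M| * Real.exp (1 / 2 * R ^ 2) * Real.exp (-(1 / 2 - ε) * ‖x‖ ^ 2) := by positivity
    linarith
  · have h1 : 1 ≤ Real.exp (1 / 2 * R ^ 2) * Real.exp (-(1 / 2 - ε) * ‖x‖ ^ 2) := by
      rw [← Real.exp_add]
      apply Real.one_le_exp
      have : ‖x‖ ^ 2 ≤ R ^ 2 := pow_le_pow_left₀ (norm_nonneg _) h 2
      nlinarith [sq_nonneg ‖x‖]
    calc ‖f x‖ ≤ |M| := (hM x h).trans (le_abs_self M)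
      _ ≤ |M| * (Real.exp (1 / 2 * R ^ 2) * Real.exp (-(1 / 2 - ε) * ‖x‖ ^ 2)) :=
          le_mul_of_one_le_right (abs_nonneg M) h1
      _ ≤ _ := by
          rw [mul_assoc]
          linarith [Real.exp_pos (-(1 / 2 - ε) * ‖x‖ ^ 2)]

/-! ### Growth, rotation and injectivity of the Bargmann transform -/

theorem norm_bargmann_le {n : ℕ} {f : EuclideanSpace ℝ (Fin n) → ℂ} {ε C : ℝ} (hε : 0 < ε)
    (hε' : ε ≤ 1 / 4) (hC : 0 ≤ C) (hf : ∀ x, ‖f x‖ ≤ C * Real.exp (-(1 / 2 - ε) * ‖x‖ ^ 2))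
    (z : Fin n → ℂ) :
    ‖bargmann f z‖ ≤ C * (∫ x : EuclideanSpace ℝ (Fin n), Real.exp (-ε * ‖x‖ ^ 2)) *
      Real.exp ((∑ j, (z j).im ^ 2) / 2 + 2 * ε * ∑ j, (z j).re ^ 2) := by
  -- The kernel estimate is used with `η = 1 - 2ε`: the Gaussian exponents then add up to `-ε‖x‖²`,
  -- and the coefficient of `|Re z|²` is `ε/(1-2ε) ≤ 2ε`.
  have hη : 0 < 1 - 2 * ε := by linarith
  have hcoef : 1 / (2 * (1 - 2 * ε)) - 1 / 2 ≤ 2 * ε := by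
    rw [sub_le_iff_le_add, div_le_iff₀ (by positivity)]
    nlinarith
  have hU : 0 ≤ ∑ j, (z j).re ^ 2 := Finset.sum_nonneg fun _ _ => sq_nonneg _
  set E := Real.exp ((∑ j, (z j).im ^ 2) / 2 + 2 * ε * ∑ j, (z j).re ^ 2)
  have hint : Integrable fun x : EuclideanSpace ℝ (Fin n) => C * E * Real.exp (-ε * ‖x‖ ^ 2) :=
    (integrable_exp_neg_mul_norm_sq n hε).const_mul _
  refine (norm_integral_le_of_norm_le hint (Eventually.of_forall fun x => ?_)).trans_eq ?_
  · rw [norm_mul]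
    have hK := norm_bargmannKernel_le z x hη
    calc ‖f x‖ * ‖bargmannKernel z x‖
        ≤ (C * Real.exp (-(1 / 2 - ε) * ‖x‖ ^ 2)) *
          (E * Real.exp (-(1 / 2 - (1 - 2 * ε)) * ‖x‖ ^ 2)) := by
          refine mul_le_mul (hf x) (hK.trans ?_) (norm_nonneg _) (by positivity)
          gcongr
          exact Real.exp_le_exp.2 (add_le_add_right (mul_le_mul_of_nonneg_right hcoef hU) _)
      _ = C * E * (Real.exp (-(1 / 2 - ε) * ‖x‖ ^ 2) *
          Real.exp (-(1 / 2 - (1 - 2 * ε)) * ‖x‖ ^ 2)) := by ring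
      _ = _ := by rw [← Real.exp_add]; ring_nf
  · rw [integral_const_mul]
    ring

/-- The Bargmann transform turns the Fourier transform into a rotation. -/
theorem bargmann_unitaryFourier {n : ℕ} {f : EuclideanSpace ℝ (Fin n) → ℂ} (hf : Integrable f)
    (z : Fin n → ℂ) :
    bargmann (unitaryFourier f) z = bargmann f fun j => -Complex.I * z j := by
  have hprod : Integrable (fun p : EuclideanSpace ℝ (Fin n) × EuclideanSpace ℝ (Fin n) =>
      Complex.exp (-Complex.I * ((inner ℝ p.2 p.1 : ℝ) : ℂ)) *
        (bargmannKernel z p.1 * f p.2)) (volume.prod volume) := by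
    refine ((integrable_bargmannKernel z).mul_prod hf).bdd_mul (c := 1) ?_ ?_
    · exact Continuous.aestronglyMeasurable (by fun_prop)
    · exact Eventually.of_forall fun p => (norm_fourierCharacter _ _).le
  have e1 : ∀ ξ, unitaryFourier f ξ * bargmannKernel z ξ =
      (((2 * Real.pi) ^ (-(n : ℝ) / 2) : ℝ) : ℂ) *
        ∫ x, Complex.exp (-Complex.I * ((inner ℝ x ξ : ℝ) : ℂ)) * (bargmannKernel z ξ * f x) := by
    intro ξ
    rw [unitaryFourier, mul_assoc, ← integral_mul_const]
    congr 2; ext x; ring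
  rw [bargmann]
  simp_rw [e1]
  rw [integral_const_mul, integral_integral_swap hprod]
  have e2 : ∀ x, ∫ ξ, Complex.exp (-Complex.I * ((inner ℝ x ξ : ℝ) : ℂ)) *
      (bargmannKernel z ξ * f x) = ((√(2 * Real.pi) : ℝ) : ℂ) ^ n *
        (f x * bargmannKernel (fun j => -Complex.I * z j) x) := by
    intro x
    have e3 : ∀ ξ, Complex.exp (-Complex.I * ((inner ℝ x ξ : ℝ) : ℂ)) *
        (bargmannKernel z ξ * f x) = Complex.exp (-Complex.I * ((inner ℝ ξ x : ℝ) : ℂ)) *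
        bargmannKernel z ξ * f x := fun ξ => by rw [real_inner_comm x ξ, mul_assoc]
    simp_rw [e3]
    rw [integral_mul_const, integral_bargmannKernel_fourier]
    ring
  simp_rw [e2]
  rw [integral_const_mul, ← mul_assoc, bargmann, unitaryFourier_const_mul, one_mul]

theorem GaussIntegrable.differentiable_bargmann {n : ℕ} {f : EuclideanSpace ℝ (Fin n) → ℂ}
    (hf : GaussIntegrable f) : Differentiable ℂ (bargmann f) := by
  rw [funext hf.bargmann_eq]
  refine differentiable_tsum_of_rapidDecay hf.rapidDecay
    (h := fun α (z : Fin n → ℂ) => ∏ j, z j ^ α j) (fun α => by fun_prop) fun R => ?_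
  refine ⟨1, max R 0, le_max_right _ _, fun α z hz => ?_⟩
  rw [one_mul]
  exact norm_prod_pow_le (fun j => (norm_le_pi_norm z j).trans (hz.trans (le_max_left _ _))) α

/-- A Gaussian-decaying function with vanishing Hermite coefficients vanishes. -/
theorem eq_zero_of_hermiteCoeff_eq_zero {n : ℕ} {d : EuclideanSpace ℝ (Fin n) → ℂ}
    (hc : Continuous d) (hd : Integrable d) (h : hermiteCoeff d = 0) : d = 0 := by
  have hB : ∀ z, bargmann d z = 0 := fun z => by
    rw [(gaussIntegrable_of_integrable hd).bargmann_eq, h]; simp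
  set g : EuclideanSpace ℝ (Fin n) → ℂ := fun x => d x * Complex.exp (-(‖x‖ : ℂ) ^ 2 / 2) with hg
  have hgc : Continuous g := hc.mul (by fun_prop)
  have hgi : Integrable g := by
    refine hd.mono hgc.aestronglyMeasurable (Eventually.of_forall fun x => ?_)
    rw [hg, norm_mul, norm_cexp_neg_norm_sq]
    exact mul_le_of_le_one_right (norm_nonneg _)
      (Real.exp_le_one_iff.2 (by nlinarith [sq_nonneg ‖x‖]))
  have hF : FourierTransform.fourier g = 0 := by
    ext ξ
    have h2 : ((√2 : ℝ) : ℂ) * √2 = 2 := by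
      rw [← Complex.ofReal_mul, Real.mul_self_sqrt (by norm_num)]; simp
    -- At this purely imaginary point the kernel is a constant times a Gaussian times the character
    -- `e^{-2πi x·ξ}`, so the vanishing Bargmann transform says that `g` has vanishing Fourier
    -- transform.
    let z : Fin n → ℂ := fun j => -Complex.I * (√2 * Real.pi * ξ j)
    have e : ∀ x, d x * bargmannKernel z x = Complex.exp (-(∑ j, z j ^ 2) / 2) *
        (Complex.exp (((-2 * Real.pi * inner ℝ x ξ : ℝ) : ℂ) * Complex.I) • g x) := by
      intro x
      have e1 : √2 * ∑ j, (x j : ℂ) * z j =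
          ((-2 * Real.pi * inner ℝ x ξ : ℝ) : ℂ) * Complex.I := by
        rw [inner_eq_sum_mul]
        push_cast
        simp only [z, Finset.mul_sum, Finset.sum_mul]
        refine Finset.sum_congr rfl fun j _ => ?_
        linear_combination (-Complex.I * Real.pi * ξ j * x j) * h2
      rw [bargmannKernel_eq, e1, sub_eq_add_neg, Complex.exp_add, Complex.exp_add, hg, smul_eq_mul,
        neg_div]
      ring_nf
    have h3 := hB z
    rw [bargmann] at h3
    simp_rw [e] at h3
    rw [integral_const_mul, mul_eq_zero, or_iff_right (Complex.exp_ne_zero _)] at h3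
    rw [Real.fourier_eq']
    exact h3
  have hinv := hgc.fourierInv_fourier_eq hgi (by rw [hF]; exact integrable_zero _ _ _)
  rw [hF] at hinv
  have hg0 : g = 0 := by
    rw [← hinv]
    ext x
    rw [Real.fourierInv_eq']
    simp
  ext x
  have := congrFun hg0 x
  simpa [hg, Complex.exp_ne_zero] using this

/-! ### Phragmén–Lindelöf argument for minimal type -/

theorem re_cexp_mul_add (ζ : ℂ) (a b : ℝ) :
    (Complex.exp ζ * a + Complex.exp (-ζ) * b).re =
      Real.cos ζ.im * (Real.exp ζ.re * a + Real.exp (-ζ.re) * b) := by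
  simp [Complex.exp_re]; ring

theorem im_cexp_mul_add (ζ : ℂ) (a b : ℝ) :
    (Complex.exp ζ * a + Complex.exp (-ζ) * b).im =
      Real.sin ζ.im * (Real.exp ζ.re * a - Real.exp (-ζ.re) * b) := by
  simp [Complex.exp_im]; ring

theorem sum_sq_add_le {n : ℕ} (s : ℝ) (a b : Fin n → ℝ) :
    ∑ j, (Real.exp s * a j + Real.exp (-s) * b j) ^ 2 ≤
      2 * (Real.exp (2 * s) * ∑ j, a j ^ 2 + Real.exp (-(2 * s)) * ∑ j, b j ^ 2) := by
  rw [Finset.mul_sum, Finset.mul_sum, ← Finset.sum_add_distrib, Finset.mul_sum]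
  refine Finset.sum_le_sum fun j _ => ?_
  have h1 : Real.exp (2 * s) = Real.exp s ^ 2 := by rw [← Real.exp_nat_mul]; norm_num
  have h2 : Real.exp (-(2 * s)) = Real.exp (-s) ^ 2 := by
    rw [← Real.exp_nat_mul]; congr 1; push_cast; ring
  rw [h1, h2]
  nlinarith [sq_nonneg (Real.exp s * a j - Real.exp (-s) * b j)]

theorem sum_sq_sub_le {n : ℕ} (s : ℝ) (a b : Fin n → ℝ) :
    ∑ j, (Real.exp s * a j - Real.exp (-s) * b j) ^ 2 ≤
      2 * (Real.exp (2 * s) * ∑ j, a j ^ 2 + Real.exp (-(2 * s)) * ∑ j, b j ^ 2) := by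
  simpa [sub_eq_add_neg] using sum_sq_add_le s a fun j => -b j

/-- An entire function on `ℂⁿ` of order two which grows slowly in the real directions and in the
imaginary directions, with the critical bounds in between, has minimal type. -/
theorem exists_minimalType_bound {n : ℕ} {B : (Fin n → ℂ) → ℂ} (hB : Differentiable ℂ B)
    (h : ∀ ε : ℝ, 0 < ε → ε ≤ 1 / 4 → ∃ C : ℝ, 0 ≤ C ∧ ∀ z,
      ‖B z‖ ≤ C * Real.exp ((∑ j, (z j).im ^ 2) / 2 + 2 * ε * ∑ j, (z j).re ^ 2) ∧
      ‖B z‖ ≤ C * Real.exp ((∑ j, (z j).re ^ 2) / 2 + 2 * ε * ∑ j, (z j).im ^ 2))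
    {δ : ℝ} (hδ : 0 < δ) :
    ∃ C : ℝ, 0 ≤ C ∧ ∀ z, ‖B z‖ ≤ C * Real.exp (δ * ∑ j, ‖z j‖ ^ 2) := by
  -- With `tan θ = d ≤ δ`, `sin²θ ≤ δ sin θ cos θ`, which is half of `δ sin 2θ`; the other half
  -- absorbs `4ε`. The cap `1/2` keeps `θ < π/4`, so the strip below is nonempty.
  set d := min δ (1 / 2)
  have hd : 0 < d := lt_min hδ (by norm_num)
  set θ := Real.arctan d with hθd
  have hθ : 0 < θ := Real.arctan_pos.2 hd
  have hθ' : θ < Real.pi / 4 := by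
    rw [← Real.arctan_one]
    exact Real.arctan_strictMono ((min_le_right _ _).trans_lt (by norm_num))
  have hcos : 0 < Real.cos θ := Real.cos_arctan_pos d
  have hsin : Real.sin θ = d * Real.cos θ := by
    rw [← Real.tan_mul_cos hcos.ne', hθd, Real.tan_arctan]
  have hsin0 : 0 < Real.sin θ := by rw [hsin]; positivity
  have hdδ : d ≤ δ := min_le_left _ _
  set ε := min (1 / 4) (Real.sin θ ^ 2 / 4)
  have hε : 0 < ε := lt_min (by norm_num) (by positivity)
  have hε4 : 4 * ε ≤ Real.sin θ ^ 2 := by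
    have : ε ≤ Real.sin θ ^ 2 / 4 := min_le_right _ _
    linarith
  have hκ : Real.sin θ ^ 2 + 4 * ε ≤ δ * Real.sin (2 * θ) := by
    rw [Real.sin_two_mul]
    have : Real.sin θ ^ 2 ≤ δ * (Real.sin θ * Real.cos θ) := by
      rw [hsin]
      have h1 : 0 ≤ d * Real.cos θ ^ 2 := by positivity
      nlinarith [mul_le_mul_of_nonneg_right hdδ h1]
    linarith
  obtain ⟨C, hC, hCB⟩ := h ε hε (min_le_left _ _)
  refine ⟨C, hC, fun w => ?_⟩
  let a : Fin n → ℝ := fun j => ((w j).re + (w j).im) / √2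
  let b : Fin n → ℝ := fun j => ((w j).re - (w j).im) / √2
  set A := ∑ j, a j ^ 2
  set A' := ∑ j, b j ^ 2
  have hA : 0 ≤ A := Finset.sum_nonneg fun _ _ => sq_nonneg _
  have hA' : 0 ≤ A' := Finset.sum_nonneg fun _ _ => sq_nonneg _
  let S : ℝ → ℝ := fun s => Real.exp (2 * s) * A + Real.exp (-(2 * s)) * A'
  have hS : ∀ s, 0 ≤ S s := fun s => by positivity
  -- This curve joins real to imaginary space through `w`: it lies in `ℝⁿ` for `Im ζ = 0`, in `iℝⁿ`
  -- for `Im ζ = π/2`, and equals `w` at `ζ = iπ/4`. It replaces the rotation of a sector in one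
  -- variable, since the complex line through `w` need not contain nonzero real vectors.
  let z : ℂ → Fin n → ℂ := fun ζ j => Complex.exp ζ * a j + Complex.exp (-ζ) * b j
  -- The exponential factor has modulus `exp(-δ sin(2 Im ζ) S(Re ζ))`. It cancels the growth of `B`
  -- on both edges and costs exactly `exp(δ‖w‖²)` at `iπ/4`.
  let g : ℂ → ℂ := fun ζ => B (z ζ) *
    Complex.exp (Complex.I * δ * (Complex.exp (2 * ζ) * A - Complex.exp (-(2 * ζ)) * A'))
  have hgd : Differentiable ℂ g := by
    have hz : Differentiable ℂ z := differentiable_pi.2 fun j => by fun_prop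
    exact (hB.comp hz).mul (by fun_prop)
  have hre : ∀ ζ, ∑ j, (z ζ j).re ^ 2 ≤ Real.cos ζ.im ^ 2 * (2 * S ζ.re) := by
    intro ζ
    simp only [z, re_cexp_mul_add, mul_pow, ← Finset.mul_sum]
    exact mul_le_mul_of_nonneg_left (sum_sq_add_le _ _ _) (sq_nonneg _)
  have him : ∀ ζ, ∑ j, (z ζ j).im ^ 2 ≤ Real.sin ζ.im ^ 2 * (2 * S ζ.re) := by
    intro ζ
    simp only [z, im_cexp_mul_add, mul_pow, ← Finset.mul_sum]
    exact mul_le_mul_of_nonneg_left (sum_sq_sub_le _ _ _) (sq_nonneg _)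
  have hg : ∀ ζ, ‖g ζ‖ = ‖B (z ζ)‖ * Real.exp (-(δ * Real.sin (2 * ζ.im) * S ζ.re)) := by
    intro ζ
    have h1 : (Complex.exp (2 * ζ) * A - Complex.exp (-(2 * ζ)) * A').im =
        Real.sin (2 * ζ.im) * S ζ.re := by
      have := im_cexp_mul_add (2 * ζ) A (-A')
      simp only [Complex.ofReal_neg, mul_neg, ← sub_eq_add_neg, sub_neg_eq_add] at this
      rw [this]
      simp [S]
    have h2 : (Complex.I * δ * (Complex.exp (2 * ζ) * A - Complex.exp (-(2 * ζ)) * A')).re =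
        -(δ * Real.sin (2 * ζ.im) * S ζ.re) := by
      rw [mul_assoc, Complex.I_mul_re, Complex.im_ofReal_mul, h1]; ring
    rw [norm_mul, Complex.norm_exp, h2]
  have hcos1 : ∀ t, Real.cos t ^ 2 ≤ 1 := Real.cos_sq_le_one
  have hsin1 : ∀ t, Real.sin t ^ 2 ≤ 1 := Real.sin_sq_le_one
  have hedge : ∀ {X s : ℝ}, X ≤ (Real.sin θ ^ 2 + 4 * ε) * S s → ∀ {y : ℝ}, y ≤ C * Real.exp X →
      y * Real.exp (-(δ * Real.sin (2 * θ) * S s)) ≤ C := by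
    intro X s hX y hy
    calc _ ≤ C * Real.exp X * Real.exp (-(δ * Real.sin (2 * θ) * S s)) := by gcongr
      _ = C * Real.exp (X - δ * Real.sin (2 * θ) * S s) := by
          rw [mul_assoc, ← Real.exp_add]; rfl
      _ ≤ C * 1 := by
          gcongr
          rw [Real.exp_le_one_iff]
          linarith [mul_le_mul_of_nonneg_right hκ (hS s)]
      _ = C := mul_one C
  have hmain : ‖g ((Real.pi / 4 : ℝ) * Complex.I)‖ ≤ C := by
    -- The strip `θ < Im ζ < π/2 - θ` is strictly narrower than `π/2`, so growth of the form `exp(c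
    -- e^{2|Re ζ|})` is admissible.
    refine PhragmenLindelof.horizontal_strip (a := θ) (b := Real.pi / 2 - θ)
      hgd.diffContOnCl ⟨2, ?_, 4 * (A + A'), ?_⟩ ?_ ?_ ?_ ?_
    · rw [lt_div_iff₀ (by linarith)]; linarith
    · refine Asymptotics.IsBigO.of_bound C ?_
      rw [eventually_inf_principal]
      refine Eventually.of_forall fun ζ hζ => ?_
      simp only [Set.mem_preimage, Set.mem_Ioo] at hζ
      rw [Real.norm_of_nonneg (Real.exp_pos _).le, hg]
      have h1 : 0 ≤ Real.sin (2 * ζ.im) :=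
        Real.sin_nonneg_of_nonneg_of_le_pi (by linarith) (by linarith)
      have h2 : Real.exp (-(δ * Real.sin (2 * ζ.im) * S ζ.re)) ≤ 1 := by
        rw [Real.exp_le_one_iff]
        have := mul_nonneg (mul_nonneg hδ.le h1) (hS ζ.re)
        linarith
      refine (mul_le_of_le_one_right (norm_nonneg _) h2).trans ((hCB _).1.trans ?_)
      gcongr
      have h3 : S ζ.re ≤ (A + A') * Real.exp (2 * |ζ.re|) := by
        have e1 : Real.exp (2 * ζ.re) ≤ Real.exp (2 * |ζ.re|) :=
          Real.exp_le_exp.2 (by linarith [le_abs_self ζ.re])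
        have e2 : Real.exp (-(2 * ζ.re)) ≤ Real.exp (2 * |ζ.re|) :=
          Real.exp_le_exp.2 (by linarith [neg_abs_le ζ.re])
        calc S ζ.re ≤ Real.exp (2 * |ζ.re|) * A + Real.exp (2 * |ζ.re|) * A' := by
              simp only [S]; gcongr
          _ = _ := by ring
      have h4 : Real.cos ζ.im ^ 2 * (2 * S ζ.re) ≤ 2 * S ζ.re :=
        mul_le_of_le_one_left (by linarith [hS ζ.re]) (hcos1 _)
      have h5 : Real.sin ζ.im ^ 2 * (2 * S ζ.re) ≤ 2 * S ζ.re :=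
        mul_le_of_le_one_left (by linarith [hS ζ.re]) (hsin1 _)
      have h6 : 2 * ε * ∑ j, (z ζ j).re ^ 2 ≤ 1 * (2 * S ζ.re) := by
        refine mul_le_mul ?_ ((hre ζ).trans h4) (Finset.sum_nonneg fun _ _ => sq_nonneg _) one_pos.le
        have : ε ≤ 1 / 4 := min_le_left _ _
        linarith
      have h7 := him ζ
      have := hS ζ.re
      linarith
    · intro ζ hζ
      rw [hg, hζ]
      refine hedge ?_ (hCB _).1
      have h1 := him ζ
      have h2 : ∑ j, (z ζ j).re ^ 2 ≤ 2 * S ζ.re :=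
        (hre ζ).trans (mul_le_of_le_one_left (by linarith [hS ζ.re]) (hcos1 _))
      rw [hζ] at h1
      linarith [mul_le_mul_of_nonneg_left h2 (show 0 ≤ 2 * ε by positivity)]
    · intro ζ hζ
      rw [hg, hζ, show 2 * (Real.pi / 2 - θ) = Real.pi - 2 * θ by ring, Real.sin_pi_sub]
      refine hedge ?_ (hCB _).2
      have h1 := hre ζ
      have h2 : ∑ j, (z ζ j).im ^ 2 ≤ 2 * S ζ.re :=
        (him ζ).trans (mul_le_of_le_one_left (by linarith [hS ζ.re]) (hsin1 _))
      rw [hζ, Real.cos_pi_div_two_sub] at h1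
      linarith [mul_le_mul_of_nonneg_left h2 (show 0 ≤ 2 * ε by positivity)]
    · simp; linarith
    · simp; linarith
  have h2pos : √2 ≠ (0 : ℝ) := by positivity
  have hzw : z ((Real.pi / 4 : ℝ) * Complex.I) = w := by
    ext j
    apply Complex.ext
    · simp only [z, re_cexp_mul_add]
      simp [a, b]
      field_simp
      ring
    · simp only [z, im_cexp_mul_add]
      simp [a, b]
      field_simp
      ring
  have hSw : S 0 = ∑ j, ‖w j‖ ^ 2 := by
    simp only [S, mul_zero, neg_zero, Real.exp_zero, one_mul, A, A', ← Finset.sum_add_distrib]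
    refine Finset.sum_congr rfl fun j _ => ?_
    rw [← Complex.normSq_eq_norm_sq, Complex.normSq_apply]
    simp only [a, b]
    field_simp
    rw [show √(2 : ℝ) ^ 2 = 2 by simp]
    ring
  rw [hg, hzw] at hmain
  have h3 : 2 * ((Real.pi / 4 : ℝ) * Complex.I).im = Real.pi / 2 := by simp; ring
  have h4 : ((Real.pi / 4 : ℝ) * Complex.I).re = 0 := by simp
  rw [h3, h4, hSw, Real.sin_pi_div_two, mul_one, Real.exp_neg, ← div_eq_mul_inv,
    div_le_iff₀ (Real.exp_pos _)] at hmain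
  exact hmain

/-! ### From minimal type to rapid decay of the Hermite coefficients -/

/-- The product of the `α_j!` divides `|α|!`, and the factors `π^{1/4}` are at least `1`. -/
theorem inv_sqrt_factorial_le_bargmannCoeff {n : ℕ} (α : Fin n → ℕ) :
    (√((multiDegree α).factorial : ℝ))⁻¹ ≤ bargmannCoeff α := by
  have hpos : ∀ j, (0 : ℝ) < √((α j).factorial : ℝ) := fun j =>
    Real.sqrt_pos.2 (by exact_mod_cast (α j).factorial_pos)
  have h1 : ∏ j, √((α j).factorial : ℝ) ≤ √((multiDegree α).factorial : ℝ) := by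
    refine Real.le_sqrt_of_sq_le ?_
    rw [← Finset.prod_pow]
    simp_rw [Real.sq_sqrt (Nat.cast_nonneg _)]
    exact_mod_cast Nat.le_of_dvd (Nat.factorial_pos _)
      (Nat.prod_factorial_dvd_factorial_sum Finset.univ α)
  calc _ ≤ (∏ j, √((α j).factorial : ℝ))⁻¹ :=
        inv_anti₀ (Finset.prod_pos fun j _ => hpos j) h1
    _ = ∏ j, (√((α j).factorial : ℝ))⁻¹ := (Finset.prod_inv_distrib _).symm
    _ ≤ _ := by
        refine Finset.prod_le_prod (fun j _ => (inv_pos.2 (hpos j)).le) fun j _ => ?_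
        rw [← one_div]
        refine div_le_div_of_nonneg_right ?_ (hpos j).le
        rw [Real.one_le_sqrt]
        exact one_le_sqrt_pi

/-- If the Bargmann transform has minimal type, then the Hermite coefficients decay rapidly. -/
theorem GaussIntegrable.rapidDecay_hermiteCoeff {n : ℕ} {f : EuclideanSpace ℝ (Fin n) → ℂ}
    (hf : GaussIntegrable f)
    (h : ∀ δ : ℝ, 0 < δ → ∃ C : ℝ, 0 ≤ C ∧
      ∀ z, ‖bargmann f z‖ ≤ C * Real.exp (δ * ∑ j, ‖z j‖ ^ 2)) :
    RapidDecay (hermiteCoeff f) := by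
  refine rapidDecay_of_bound fun T hT => ?_
  set L := Real.exp 1 * T with hL
  have hL0 : 0 < L := by positivity
  -- On the polycircle of radius `r = √(m+1) L` this `δ` makes the exponent at most `m+1`. In
  -- Cauchy's inequality `√(m+1)^m` outweighs `√m!`, leaving `L^m`, and the factor `e` in `L` pays
  -- for `e^m`.
  set δ := 1 / ((n + 1 : ℝ) * L ^ 2) with hδd
  have hδ : 0 < δ := by positivity
  obtain ⟨C, hC, hB⟩ := h δ hδ
  refine ⟨C * Real.exp 1, fun α => ?_⟩
  set m := multiDegree α
  have hm : (0 : ℝ) < (m : ℝ) + 1 := by positivity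
  set r := √((m : ℝ) + 1) * L with hr
  have hr0 : 0 < r := by positivity
  have hr2 : r ^ 2 = ((m : ℝ) + 1) * L ^ 2 := by rw [hr, mul_pow, Real.sq_sqrt hm.le]
  have hcauchy := norm_coeff_le_of_norm_tsum_le hr0 (hf.rapidDecay r hr0.le)
    (M := C * Real.exp ((m : ℝ) + 1)) (fun z hz => by
      rw [← hf.bargmann_eq]
      refine (hB z).trans ?_
      gcongr
      simp only [hz, Finset.sum_const, Finset.card_univ, Fintype.card_fin, nsmul_eq_mul, hr2]
      have : δ * (n * (((m : ℝ) + 1) * L ^ 2)) = (m + 1) * (n / (n + 1)) := by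
        rw [hδd]; field_simp
      rw [this]
      refine mul_le_of_le_one_right hm.le ?_
      rw [div_le_one (by positivity)]
      linarith) α
  rw [norm_mul, Complex.norm_real, Real.norm_of_nonneg (bargmannCoeff_pos α).le] at hcauchy
  change bargmannCoeff α * ‖hermiteCoeff f α‖ * r ^ m ≤ _ at hcauchy
  have hfac : √(m.factorial : ℝ) ≤ √((m : ℝ) + 1) ^ m := by
    rw [Real.sqrt_le_left (by positivity), ← pow_mul, mul_comm m 2, pow_mul, Real.sq_sqrt hm.le]
    calc (m.factorial : ℝ) ≤ (m : ℝ) ^ m := by exact_mod_cast Nat.factorial_le_pow m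
      _ ≤ _ := by gcongr; linarith
  have hsf : 0 < √(m.factorial : ℝ) := Real.sqrt_pos.2 (by exact_mod_cast m.factorial_pos)
  have h1 : (√(m.factorial : ℝ))⁻¹ * ‖hermiteCoeff f α‖ * r ^ m ≤ C * Real.exp ((m : ℝ) + 1) :=
    le_trans (by gcongr; exact inv_sqrt_factorial_le_bargmannCoeff α) hcauchy
  have h2 : L ^ m ≤ (√(m.factorial : ℝ))⁻¹ * r ^ m := by
    have hrm : r ^ m = √((m : ℝ) + 1) ^ m * L ^ m := by rw [hr, mul_pow]
    rw [hrm, ← mul_assoc]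
    refine le_mul_of_one_le_left (show (0 : ℝ) ≤ L ^ m by positivity) ?_
    rw [← div_eq_inv_mul, one_le_div hsf]
    exact hfac
  have h3 : ‖hermiteCoeff f α‖ * L ^ m ≤ C * Real.exp ((m : ℝ) + 1) := by
    refine le_trans ?_ h1
    calc _ ≤ ‖hermiteCoeff f α‖ * ((√(m.factorial : ℝ))⁻¹ * r ^ m) := by gcongr
      _ = _ := by ring
  have h4 : L ^ m = Real.exp m * T ^ m := by
    rw [hL, mul_pow, ← Real.exp_nat_mul, mul_one]
  rw [h4, Real.exp_add] at h3
  have := Real.exp_pos (m : ℝ)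
  refine le_of_mul_le_mul_left ?_ this
  linarith

/-! ### The Pfannschmidt condition implies a rapidly decaying expansion -/

theorem norm_unitaryFourier_le {n : ℕ} (f : EuclideanSpace ℝ (Fin n) → ℂ)
    (ξ : EuclideanSpace ℝ (Fin n)) :
    ‖unitaryFourier f ξ‖ ≤ (2 * Real.pi) ^ (-(n : ℝ) / 2) * ∫ x, ‖f x‖ := by
  rw [unitaryFourier, norm_mul, Complex.norm_real, Real.norm_of_nonneg (by positivity)]
  gcongr
  refine (norm_integral_le_integral_norm _).trans_eq ?_
  simp_rw [norm_mul, norm_fourierCharacter, one_mul]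

/-- A continuous function satisfying the Pfannschmidt condition is the sum of a Hermite series
with rapidly decaying coefficients. -/
theorem PfannschmidtCondition.eq_hermiteSeries {n : ℕ} {f : EuclideanSpace ℝ (Fin n) → ℂ}
    (hf : PfannschmidtCondition 1 1 f) (hc : Continuous f) :
    RapidDecay (hermiteCoeff f) ∧ f = hermiteSeries (hermiteCoeff f) := by
  obtain ⟨-, P, Q, hP, hQ, hfP, hfQ, hlP, hlQ⟩ := hf
  have hbf : ∀ R : ℝ, ∃ M, ∀ x, ‖x‖ ≤ R → ‖f x‖ ≤ M := fun R => by
    obtain ⟨M, hM⟩ := (isCompact_closedBall (0 : EuclideanSpace ℝ (Fin n)) R).exists_bound_of_continuousOn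
      hc.continuousOn
    exact ⟨M, fun x hx => hM x (by simpa using hx)⟩
  have hgf := fun {ε : ℝ} (hε : 0 < ε) => hlP.exists_gauss_bound hP hfP hbf hε
  have hgF := fun {ε : ℝ} (hε : 0 < ε) => hlQ.exists_gauss_bound hQ hfQ
    (fun _ => ⟨_, fun ξ _ => norm_unitaryFourier_le f ξ⟩) hε
  have hi : Integrable f := by
    obtain ⟨C, -, h⟩ := hgf (show (0 : ℝ) < 1 / 4 by norm_num)
    exact integrable_of_gauss_bound hc (by norm_num) h
  have hG := gaussIntegrable_of_integrable hi
  have hdecay : RapidDecay (hermiteCoeff f) := by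
    refine hG.rapidDecay_hermiteCoeff fun δ hδ =>
      exists_minimalType_bound hG.differentiable_bargmann (fun ε hε hε' => ?_) hδ
    obtain ⟨C₁, hC₁, h₁⟩ := hgf hε
    obtain ⟨C₂, hC₂, h₂⟩ := hgF hε
    set K := ∫ x : EuclideanSpace ℝ (Fin n), Real.exp (-ε * ‖x‖ ^ 2)
    have hK : 0 ≤ K := integral_nonneg fun _ => (Real.exp_pos _).le
    refine ⟨(C₁ + C₂) * K, by positivity, fun z => ⟨?_, ?_⟩⟩
    · refine (norm_bargmann_le hε hε' hC₁ h₁ z).trans ?_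
      gcongr
      linarith
    -- Evaluating the transform of the Fourier transform at `iz` gives the transform of `f` at `z`;
    -- since multiplication by `i` exchanges the squares of real and imaginary parts, this is the
    -- second critical bound.
    · have h := norm_bargmann_le hε hε' hC₂ h₂ fun j => Complex.I * z j
      rw [bargmann_unitaryFourier hi] at h
      change _ ≤ C₂ * K * _ at h
      simp only [← mul_assoc, neg_mul, Complex.I_mul_I, neg_neg, one_mul, Complex.I_mul_im,
        Complex.I_mul_re, neg_sq] at h
      refine h.trans ?_
      gcongr
      linarith
  refine ⟨hdecay, ?_⟩
  have hsi := hdecay.integrable_hermiteSeries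
  rw [← sub_eq_zero]
  refine eq_zero_of_hermiteCoeff_eq_zero (hc.sub hdecay.continuous_hermiteSeries) (hi.sub hsi) ?_
  ext α
  obtain ⟨_, _, -, -, h₁⟩ := hG.exists_integral_le
  obtain ⟨_, _, -, -, h₂⟩ := (gaussIntegrable_of_integrable hsi).exists_integral_le
  rw [hermiteCoeff]
  simp_rw [Pi.sub_apply, sub_mul]
  rw [integral_sub (h₁ α).1 (h₂ α).1]
  have := congrFun hdecay.hermiteCoeff_hermiteSeries α
  rw [hermiteCoeff] at this
  rw [this, hermiteCoeff, sub_self, Pi.zero_apply]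

end

theorem theorem1p4 (n : ℕ) (hn : 1 ≤ n) (F : EuclideanSpace ℂ (Fin n) → ℂ)
    (hF : Differentiable ℂ F) :
    (F ∈ HermiteBergmanInf n ↔ PfannschmidtCondition 1 1 (realRestriction F)) ∧
    (F ∈ HermiteBergmanInf n →
      Integrable (realRestriction F) volume ∧
      ∃ G ∈ HermiteBergmanInf n,
        (∀ ξ, realRestriction G ξ = unitaryFourier (realRestriction F) ξ) ∧
        IsEntireOrderTwoMinimalType (mulExpHalfSq F) ∧
        IsEntireOrderTwoMinimalType (mulExpHalfSq G)) := by
  -- An expansion on `ℝⁿ` alone determines `F` on `ℂⁿ`, so membership and growth can be read off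
  -- from the coefficients.
  have hext : ∀ {c : (Fin n → ℕ) → ℂ}, RapidDecay c → realRestriction F = hermiteSeries c →
      F = hermiteEntire c := fun hc h =>
    eq_of_realRestriction_eq hF hc.differentiable_hermiteEntire
      (h.trans (realRestriction_hermiteEntire _).symm)
  refine ⟨⟨fun h => ?_, fun h => ?_⟩, fun h => ?_⟩
  · obtain ⟨hc, he⟩ := realRestriction_eq_hermiteSeries h
    rw [he]
    exact hc.pfannschmidtCondition hn
  · obtain ⟨hc, he⟩ := h.eq_hermiteSeries (hF.continuous.comp continuous_realToComplex)
    rw [hext hc he]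
    exact hc.hermiteEntire_mem
  · obtain ⟨hc, he⟩ := realRestriction_eq_hermiteSeries h
    refine ⟨he ▸ hc.integrable_hermiteSeries, _, hc.rotate.hermiteEntire_mem, fun ξ => ?_, ?_, ?_⟩
    · rw [realRestriction_hermiteEntire, ← hc.unitaryFourier_hermiteSeries, ← he]
    · rw [hext hc he, mulExpHalfSq_hermiteEntire]
      exact hc.isEntireOrderTwoMinimalType
    · rw [mulExpHalfSq_hermiteEntire]
      exact hc.rotate.isEntireOrderTwoMinimalType
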